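/- Let $M=(S,A,T,R)$ be a finite Markov decision problem with $n=|S|\ge 1$ states, $k=|A|\ge 1$ actions, transition probabilities $T(s,a,s')$ and real rewards $R(s,a)$. A policy is a map $\pi:S\to A$; write $P^\pi=(T(s,\pi(s),s'))_{s,s'}$, $r^\pi=(R(s,\pi(s)))_s$, and let $V^\pi_\gamma=\sum_{t\ge0}\gamma^t(P^\pi)^t r^\pi$ be its discounted value and $Q^\pi_\gamma(s,a)=R(s,a)+\gamma\sum_{s'}T(s,a,s')V^\pi_\gamma(s')$. A policy $\pi$ is Blackwell-optimal (BO) if there is $\gamma'\in[0,1)$ with $V^\pi_\gamma(s)\ge V^{\pi'}_\gamma(s)$ for all $\gamma\in[\gamma',1)$, all policies $\pi'$ and all $s\in S$. By Cramer's rule, $V^\pi_\gamma(s)$, $Q^\pi_\gamma(s,a)$ and $\hat f^\pi(s,a)=Q^\pi_\gamma(s,a)-V^\pi_\gamma(s)$ are rational functions of $\gamma$. They are compared in the $\mu$-ordering: if $r_1-r_2=\frac{(1-x)^{c_1}\bar\eta(x)}{(1-x)^{c_2}\bar\delta(x)}$ with polynomials $\bar\eta,\bar\delta$ that do not vanish at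 $1$, then $r_1\succ r_2$ iff $\bar\eta(1)\bar\delta(1)>0$. *Random-Facet-Blackwell.* On a set $G$ of state-action pairs and a policy $\pi$ all of whose pairs $(s,\pi(s))$ lie in $G$: if no $p\in G$ has $\hat f^\pi(p)\succ0$, return $\pi$. Otherwise pick $p\in G\setminus\{(s,\pi(s)):s\in S\}$ uniformly at random and recursively compute $\pi'$ from $(G\setminus\{p\},\pi)$. If $\hat f^{\pi'}(p)\succ0$, switch $\pi'$ to $p$ and return the result of a recursive call on $G$ and the switched policy; otherwise return $\pi'$. *Combination with Clarkson's method (iterative reweighting).* If $nk\le 6n^2$, run Random-Facet-Blackwell on $S\times A$ from the initial policy $\pi_0$. Otherwise give all pairs weight $1$ and repeat: draw a random $6n^2$-element sub-multiset of the pairs (counted with their integer weights); run Random-Facet-Blackwell from $\pi_0$ on the drawn pairs together with the pairs of $\pi_0$, obtaining $\pi$; let $V$ be the set of all $p\in S\times A$ with $\hat f^\pi(p)\succ 0$. If $V=\emptyset$, return $\pi$; if the weight of $V$ is at most $\frac1{3n}$ of the total weight, double the weights of the pairs in $V$. An iteration is a call of Random-Facet-Blackwell, an evaluation of the sign of some $\hat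 f^\pi(p)$, a round of the reweighting method, or the drawing of one pair. **Theorem.** There is an absolute constant $C$ such that for every such $M$ and every initial policy $\pi_0$: 1. Random-Facet-Blackwell, started with all pairs $S\times A$ and $\pi_0$, terminates with probability $1$, always returns a BO policy, and its expected number of iterations is at most $C(nk)^C e^{C\sqrt{n\log(nk)}}$ (hence $\mathrm{poly}(n,k)\cdot e^{O(\sqrt{n\log n})}$ whenever $k$ is bounded by a polynomial in $n$ and $n\ge2$). 2. Random-Facet-Blackwell combined with Clarkson's method terminates with probability $1$, always returns a BO policy, and its expected number of iterations is at most $C(nk)^C e^{C\sqrt{n\log n}}$, that is, $\mathrm{poly}(n,k)\cdot e^{O(\sqrt{n\log n})}$. -/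

import Mathlib

open scoped ENNReal Polynomial

universe u v

noncomputable section

/-! ### Finite Markov decision problems, policies and discounted values -/

/-- A Markov decision problem with states `S`, actions `A`, transition probabilities `T s a s'`
and mean rewards `R s a`. -/
structure MDP (S : Type u) (A : Type v) [Fintype S] where
  T : S → A → S → ℝ
  R : S → A → ℝ
  T_nonneg : ∀ s a s', 0 ≤ T s a s'
  T_sum : ∀ s a, ∑ s', T s a s' = 1

/-- Policies: `π s` is the action taken in state `s`. -/
abbrev Policy (S : Type u) (A : Type v) : Type (max u v) := S → A

namespace MDP

variable {S : Type u} {A : Type v} [Fintype S] [DecidableEq S]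

/-- The stochastic matrix `P^π`. -/
def transMatrix (M : MDP S A) (π : Policy S A) : Matrix S S ℝ :=
  Matrix.of fun s s' => M.T s (π s) s'

/-- The reward vector `r^π`. -/
def rewardVec (M : MDP S A) (π : Policy S A) : S → ℝ := fun s => M.R s (π s)

/-- The discounted value `V^π_γ(s)`: the expected reward at time `t` when following `π` from `s`
is the `s`-entry of `(P^π)^t r^π`.  For `0 ≤ γ < 1` the series converges absolutely. -/
def value (M : MDP S A) (γ : ℝ) (π : Policy S A) (s : S) : ℝ :=
  ∑' t : ℕ, γ ^ t * ((M.transMatrix π ^ t).mulVec (M.rewardVec π)) s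

/-- Blackwell optimality. -/
def IsBlackwellOptimal (M : MDP S A) (π : Policy S A) : Prop :=
  ∃ γ' : ℝ, 0 ≤ γ' ∧ γ' < 1 ∧
    ∀ γ : ℝ, γ' ≤ γ → γ < 1 → ∀ (π' : Policy S A) (s : S), M.value γ π' s ≤ M.value γ π s

end MDP

/-! ### The `μ`-ordering of rational functions near `1` -/

/-- For `p = (1 - x)^c * q` with `c` the multiplicity of the root `1` of `p`, this is `q(1)`
(it is nonzero unless `p = 0`). -/
def coreAtOne (p : ℝ[X]) : ℝ :=
  (-1) ^ p.rootMultiplicity 1 *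
    (p /ₘ (Polynomial.X - Polynomial.C 1) ^ p.rootMultiplicity 1).eval 1

/-- `r₁ ≻ r₂` in the `μ`-ordering. -/
def muGT (r₁ r₂ : RatFunc ℝ) : Prop :=
  0 < coreAtOne (r₁ - r₂).num * coreAtOne (r₁ - r₂).denom

namespace MDP

variable {S : Type u} {A : Type v} [Fintype S] [DecidableEq S]

/-- The matrix `I - γ P^π` with `γ` the polynomial variable. -/
def bellmanMatrix (M : MDP S A) (π : Policy S A) : Matrix S S ℝ[X] :=
  1 - (Polynomial.X : ℝ[X]) • (M.transMatrix π).map Polynomial.C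

/-- The value `V^π_γ(s)` as a rational function of `γ`, by Cramer's rule. -/
def valueRat (M : MDP S A) (π : Policy S A) (s : S) : RatFunc ℝ :=
  algebraMap ℝ[X] (RatFunc ℝ)
      (((M.bellmanMatrix π).updateCol s fun t => Polynomial.C (M.rewardVec π t)).det) /
    algebraMap ℝ[X] (RatFunc ℝ) (M.bellmanMatrix π).det

/-- The action value `Q^π_γ(s, a)` as a rational function of `γ`. -/
def qRat (M : MDP S A) (π : Policy S A) (s : S) (a : A) : RatFunc ℝ :=
  RatFunc.C (M.R s a) + RatFunc.X * ∑ s', RatFunc.C (M.T s a s') * M.valueRat π s'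

/-- The rational function `Q^π_γ(s, a) - V^π_γ(s)` of `γ`, for the pair `p = (s, a)`. -/
def gainRat (M : MDP S A) (π : Policy S A) (p : S × A) : RatFunc ℝ :=
  M.qRat π p.1 p.2 - M.valueRat π p.1

/-- The sign test of the algorithm: `p` is improving for `π` if `Q - V ≻ 0`. -/
def Improving (M : MDP S A) (π : Policy S A) (p : S × A) : Prop :=
  muGT (M.gainRat π p) 0

end MDP

/-! ### Randomised computations with a step count -/

/-- A randomised computation, given by the joint law of its result and of the number of steps
it has performed.  The result `none` means that the computation was cut off. -/
structure RandM (α : Type u) where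
  law : PMF (Option α × ℕ)

namespace RandM

/-- Run `m`, then `g` on its result; steps add up, and a cut-off is passed on. -/
def bindAux {α β : Type u} (m : RandM α) (g : α → RandM β) : RandM β :=
  ⟨m.law.bind fun x =>
    match x with
    | (none, c) => PMF.pure (none, c)
    | (some a, c) => (g a).law.map fun y => (y.1, c + y.2)⟩

instance : Monad RandM where
  pure a := ⟨PMF.pure (some a, 0)⟩
  bind m g := bindAux m g

/-- Cut the computation off. -/
def abort {α : Type u} : RandM α := ⟨PMF.pure (none, 0)⟩

/-- Count `c` steps. -/
def tick (c : ℕ) : RandM PUnit.{u + 1} := ⟨PMF.pure (some PUnit.unit, c)⟩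

open Classical in
/-- A uniformly random element of a nonempty finite set, drawn with fresh randomness. -/
def uniformFrom {α : Type u} (s : Finset α) : RandM α :=
  if h : s.Nonempty then ⟨(PMF.uniformOfFinset s h).map fun a => (some a, 0)⟩ else abort

/-! A possibly non-terminating randomised algorithm is presented by its truncations `run f`,
`f = 0, 1, 2, …`: the same algorithm, cut off as soon as its recursion depth (or number of rounds)
would exceed `f`. -/

/-- With probability `1` the algorithm terminates with a result (is eventually not cut off). -/
def TerminatesAlmostSurely {α : Type u} (run : ℕ → RandM α) : Prop :=
  Filter.Tendsto (fun f => ∑' c : ℕ, (run f).law (none, c)) Filter.atTop (nhds 0)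

/-- Every result that the algorithm can return satisfies `P`. -/
def AlwaysReturns {α : Type u} (run : ℕ → RandM α) (P : α → Prop) : Prop :=
  ∀ (f : ℕ) (a : α) (c : ℕ), (run f).law (some a, c) ≠ 0 → P a

/-- The expected number of steps of the algorithm, the limit (by monotone convergence) of the
expected numbers of steps performed before the cut-offs. -/
def expectedSteps {α : Type u} (run : ℕ → RandM α) : ℝ≥0∞ :=
  ⨆ f : ℕ, ∑' x : Option α × ℕ, (run f).law x * (x.2 : ℝ≥0∞)

end RandM

/-! ### The algorithms -/

namespace MDP

variable {S : Type u} {A : Type v} [Fintype S] [DecidableEq S] [DecidableEq A]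

/-- The set `π_p` of the state-action pairs of `π`. -/
def pairs (π : Policy S A) : Finset (S × A) := Finset.univ.image fun s => (s, π s)

/-- `switch(p, π)`: use the action of `p` in the state of `p`. -/
def switch (p : S × A) (π : Policy S A) : Policy S A := Function.update π p.1 p.2

open Classical in
/-- Random-Facet-Blackwell on the set `G` of available state-action pairs, from the policy `π`,
cut off at recursion depth `f`.  Every call and every evaluation of the sign of a rational
function `Q - V` counts as one step. -/
def randomFacet (M : MDP S A) :
    ℕ → Finset (S × A) → Policy S A → RandM.{max u v} (Policy S A)
  | 0, _, _ => RandM.abort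
  | f + 1, G, π => do
      RandM.tick (1 + G.card)
      if ∀ p ∈ G, ¬ M.Improving π p then
        return π
      else
        let p ← RandM.uniformFrom (G \ pairs π)
        let π' ← randomFacet M f (G.erase p) π
        RandM.tick 1
        if M.Improving π' p then
          randomFacet M f G (switch p π')
        else
          return π'

variable [Fintype A]

/-- The multiset of all state-action pairs in which `p` occurs `2 ^ w p` times. -/
abbrev Copies (w : S × A → ℕ) : Type (max u v) := Σ p : S × A, Fin (2 ^ w p)

open Classical in
/-- The rounds of Clarkson's iterative reweighting method, at most `j` of them, where `p` has the
current weight `2 ^ w p`.  A round draws a uniformly random `6 n²`-element sub-multiset of the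
weighted pairs, solves the sampled problem (with the pairs of the initial policy `π₀` added, so
that an action is available in each state) by Random-Facet-Blackwell, and determines the set `V` of
the pairs that are improving for the policy found.  If there are none, this policy is returned;
otherwise the weights of the pairs in `V` are doubled, provided that the total weight of `V` is at
most the fraction `1 / (3 n)` of the weight of all pairs. -/
def clarksonLoop (M : MDP S A) (π₀ : Policy S A) (f : ℕ) :
    ℕ → (S × A → ℕ) → RandM.{max u v} (Policy S A)
  | 0, _ => RandM.abort
  | j + 1, w => do
      RandM.tick (1 + 6 * Fintype.card S ^ 2 + Fintype.card S * Fintype.card A)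
      let Q ← RandM.uniformFrom
        ((Finset.univ : Finset (Copies w)).powersetCard (6 * Fintype.card S ^ 2))
      let π ← randomFacet M f (Q.image Sigma.fst ∪ pairs π₀) π₀
      let V : Finset (S × A) := Finset.univ.filter fun p => M.Improving π p
      if V = ∅ then
        return π
      else if 3 * Fintype.card S * ∑ p ∈ V, 2 ^ w p ≤ ∑ p, 2 ^ w p then
        clarksonLoop M π₀ f j fun p => if p ∈ V then w p + 1 else w p
      else
        clarksonLoop M π₀ f j w

/-- Random-Facet-Blackwell on all state-action pairs, started from `π₀`. -/
def randomFacetBlackwell (M : MDP S A) (π₀ : Policy S A) (f : ℕ) :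
    RandM.{max u v} (Policy S A) :=
  randomFacet M f Finset.univ π₀

/-- Random-Facet-Blackwell combined with Clarkson's method: problems with at most `6 n²` pairs are
solved directly, larger ones by reweighting, starting with all weights equal to `1`. -/
def clarksonRandomFacetBlackwell (M : MDP S A) (π₀ : Policy S A) (f : ℕ) :
    RandM.{max u v} (Policy S A) :=
  if Fintype.card S * Fintype.card A ≤ 6 * Fintype.card S ^ 2 then
    randomFacetBlackwell M π₀ f
  else
    clarksonLoop M π₀ f f fun _ => 0

end MDP

end

/-!
Both algorithms are analysed at one fixed discount factor. The sign of a rational function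
immediately to the left of `1` is the sign that the `μ`-ordering reads off, and there are finitely
many policies and pairs, so there is `γ' < 1` such that for all `γ ∈ [γ', 1)` a pair is improving in
the sense of the algorithm iff `V^π_γ < Q^π_γ` there (`MDP.exists_discount_improving_iff`). Hence a
policy without improving pairs is Blackwell-optimal, and `Val π = ∑ s, V^π_{γ'}(s)` is a scalar
objective that every switch to an improving pair increases strictly (`MDP.isObjective_sum_value`).

*Random-Facet-Blackwell* (`MDP.cost_randomFacet_le`). The hidden dimension of `(G, π)` is the number
of states whose pair in `π` is not *enforced*, that is, not common to all policies inside `G` that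
are at least as good as `π`. Let `W p` be the optimum over `G \ {p}`, and let `i` be the rank of the
removed pair `p` with respect to `W`. If `p` is improving after the first recursive call, the
switched policy is better than `W p`, so that the `i` pairs `q` with `W q ≤ W p` become enforced and
the second call has hidden dimension at most `d - i`. As `p` is uniform among the `m` pairs outside
`π`, the expected numbers of steps `t(d, m)` satisfy
`t(d, m) ≤ t(d, m - 1) + (1 / m) ∑_{1 ≤ i ≤ min(d, m)} t(d - i, m) + |G| + 2`.
This recursion has the supersolution `(|G| + 2) K_r(m) (1 + 1 / r) ^ d` for every `r ≥ 1`, with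
`K_r = facetFactor r` (`facetFactor_succ`), and `r ≈ √(n / log N)` gives the subexponential bound
for `N` pairs (`exists_facetFactor_le`).

*Clarkson's method* (`MDP.cost_clarksonLoop_le`). On average over the samples of size `6 n²`, the
pairs that are improving for the optimum of the sample have at most the fraction `1 / (6 n)` of the
total weight (`MDP.sum_card_improving_le`), so by Markov's inequality a round fails to double with
probability at most `1 / 2`. Every doubling hits a pair of a fixed optimal policy, whose weights
therefore outgrow the total weight after `O(n² k)` doublings (`MDP.WeightsAfter.le`). All samples
have at most `7 n²` pairs, so `log N = O(log n)` up to constants.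

Termination follows from the bounds on the expected numbers of steps, since a computation cut off at
level `f` has performed at least `f` steps
(`RandM.terminatesAlmostSurely_of_expectedSteps_lt_top`).
-/

/-! ### Supports and expected step counts of randomised computations -/

namespace RandM

variable {α β : Type u}

/-- Every outcome (result and step count) of positive probability satisfies `P`. -/
def Ensures (m : RandM α) (P : Option α → ℕ → Prop) : Prop :=
  ∀ x c, m.law (x, c) ≠ 0 → P x c

/-- The expected number of steps of a randomised computation. -/
noncomputable def cost (m : RandM α) : ℝ≥0∞ := ∑' x : Option α × ℕ, m.law x * (x.2 : ℝ≥0∞)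

theorem tsum_bind_mul {γ δ : Type*} (p : PMF γ) (k : γ → PMF δ) (F : δ → ℝ≥0∞) :
    ∑' y, (p.bind k) y * F y = ∑' x, p x * ∑' y, k x y * F y := by
  simp only [PMF.bind_apply, ← ENNReal.tsum_mul_right, ← ENNReal.tsum_mul_left]
  rw [ENNReal.tsum_comm]
  simp only [mul_assoc]

theorem tsum_pure_mul {γ : Type*} (a : γ) (F : γ → ℝ≥0∞) :
    ∑' y, (PMF.pure a) y * F y = F a := by
  rw [tsum_eq_single a]
  · simp
  · intro b hb
    simp [PMF.pure_apply, hb]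

theorem tsum_map_mul {γ δ : Type*} (p : PMF γ) (g : γ → δ) (F : δ → ℝ≥0∞) :
    ∑' y, (p.map g) y * F y = ∑' x, p x * F (g x) := by
  rw [PMF.map, tsum_bind_mul]
  simp only [Function.comp_apply, tsum_pure_mul]

theorem cost_pure (a : α) : cost (pure a : RandM α) = 0 := by
  change ∑' x, (PMF.pure (some a, 0)) x * ((Prod.snd x : ℕ) : ℝ≥0∞) = 0
  rw [tsum_pure_mul]
  simp

theorem cost_abort : cost (abort : RandM α) = 0 := by
  change ∑' x, (PMF.pure (none, 0)) x * ((Prod.snd x : ℕ) : ℝ≥0∞) = 0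
  rw [tsum_pure_mul]
  simp

theorem cost_tick (c : ℕ) : cost (tick.{u} c) = c := by
  change ∑' x, (PMF.pure (some PUnit.unit, c)) x * ((Prod.snd x : ℕ) : ℝ≥0∞) = c
  rw [tsum_pure_mul]

theorem cost_bind_eq (m : RandM α) (g : α → RandM β) :
    cost (m >>= g) = cost m +
      ∑' x : Option α × ℕ, m.law x * (x.1.elim 0 fun a => cost (g a)) := by
  change ∑' y, (m.law.bind _) y * ((Prod.snd y : ℕ) : ℝ≥0∞) = _
  rw [tsum_bind_mul, cost, ← ENNReal.tsum_add]
  refine tsum_congr fun x => ?_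
  rw [← mul_add]
  congr 1
  rcases x with ⟨_ | a, c⟩
  · simp only [tsum_pure_mul, Option.elim_none, add_zero]
  · simp only [tsum_map_mul, Nat.cast_add, mul_add, ENNReal.tsum_add, Option.elim_some, cost]
    rw [ENNReal.tsum_mul_right, PMF.tsum_coe, one_mul]

theorem cost_bind_le (m : RandM α) (g : α → RandM β) (b : ℝ≥0∞)
    (h : ∀ a c, m.law (some a, c) ≠ 0 → cost (g a) ≤ b) : cost (m >>= g) ≤ cost m + b := by
  rw [cost_bind_eq]
  gcongr
  calc ∑' x : Option α × ℕ, m.law x * (x.1.elim 0 fun a => cost (g a))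
      ≤ ∑' x : Option α × ℕ, m.law x * b := by
        refine ENNReal.tsum_le_tsum fun x => ?_
        by_cases hx : m.law x = 0
        · simp [hx]
        · gcongr
          rcases x with ⟨_ | a, c⟩
          · simp
          · exact h a c hx
    _ = b := by rw [ENNReal.tsum_mul_right, PMF.tsum_coe, one_mul]

theorem cost_tick_bind_le (c : ℕ) (g : PUnit → RandM β) :
    cost (tick c >>= g) ≤ c + cost (g PUnit.unit) := by
  have h := cost_bind_le (tick c) g (cost (g PUnit.unit)) fun _ _ _ => le_rfl
  rwa [cost_tick] at h

theorem cost_uniformFrom_bind (s : Finset α) (hs : s.Nonempty) (g : α → RandM β) :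
    cost (uniformFrom s >>= g) = (s.card : ℝ≥0∞)⁻¹ * ∑ a ∈ s, cost (g a) := by
  have hlaw : (uniformFrom s).law = (PMF.uniformOfFinset s hs).map fun a => (some a, 0) := by
    simp [uniformFrom, hs]
  rw [cost_bind_eq, cost, hlaw, tsum_map_mul, tsum_map_mul]
  simp only [Nat.cast_zero, mul_zero, tsum_zero, zero_add, Option.elim_some,
    PMF.uniformOfFinset_apply]
  rw [tsum_eq_sum (s := s)]
  · rw [Finset.mul_sum]
    refine Finset.sum_congr rfl fun a ha => ?_
    simp [ha]
  · intro a ha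
    simp [ha]

theorem ensures_pure {P : Option α → ℕ → Prop} (a : α) (h : P (some a) 0) :
    Ensures (pure a : RandM α) P := by
  intro x c hx
  change (PMF.pure (some a, 0)) (x, c) ≠ 0 at hx
  rw [← PMF.mem_support_iff, PMF.mem_support_pure_iff] at hx
  cases hx
  exact h

theorem ensures_abort {P : Option α → ℕ → Prop} (h : P none 0) :
    Ensures (abort : RandM α) P := by
  intro x c hx
  change (PMF.pure (none, 0)) (x, c) ≠ 0 at hx
  rw [← PMF.mem_support_iff, PMF.mem_support_pure_iff] at hx
  cases hx
  exact h

theorem ensures_bind {P : Option β → ℕ → Prop} (m : RandM α) (g : α → RandM β)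
    (hn : ∀ c, m.law (none, c) ≠ 0 → P none c)
    (hs : ∀ a c, m.law (some a, c) ≠ 0 → Ensures (g a) fun x c' => P x (c + c')) :
    Ensures (m >>= g) P := by
  intro y c hy
  change (m.law.bind _) (y, c) ≠ 0 at hy
  rw [← PMF.mem_support_iff, PMF.mem_support_bind_iff] at hy
  obtain ⟨⟨_ | a, c₁⟩, hx, hy⟩ := hy
  · rw [PMF.mem_support_pure_iff] at hy
    cases hy
    exact hn c hx
  · rw [PMF.mem_support_map_iff] at hy
    obtain ⟨⟨z, c₂⟩, hz, hy⟩ := hy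
    cases hy
    exact hs a c₁ hx z c₂ hz

theorem ensures_tick_bind {P : Option β → ℕ → Prop} (c : ℕ) (g : PUnit → RandM β)
    (h : Ensures (g PUnit.unit) fun x c' => P x (c + c')) : Ensures (tick c >>= g) P := by
  refine ensures_bind _ _ ?_ ?_
  · intro c' hc'
    change (PMF.pure (some PUnit.unit, c)) (none, c') ≠ 0 at hc'
    simp [PMF.pure_apply] at hc'
  · rintro ⟨⟩ c' hc'
    change (PMF.pure (some PUnit.unit, c)) (some PUnit.unit, c') ≠ 0 at hc'
    rw [← PMF.mem_support_iff, PMF.mem_support_pure_iff] at hc'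
    cases hc'
    exact h

theorem ensures_uniformFrom_bind {P : Option β → ℕ → Prop} (s : Finset α) (hs : s.Nonempty)
    (g : α → RandM β) (h : ∀ a ∈ s, Ensures (g a) P) : Ensures (uniformFrom s >>= g) P := by
  have hlaw : (uniformFrom s).law = (PMF.uniformOfFinset s hs).map fun a => (some a, 0) := by
    simp [uniformFrom, hs]
  have key : ∀ x c, (uniformFrom s).law (x, c) ≠ 0 → ∃ a ∈ s, x = some a ∧ c = 0 := by
    intro x c hx
    rw [hlaw, ← PMF.mem_support_iff, PMF.mem_support_map_iff] at hx
    obtain ⟨a, ha, hx⟩ := hx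
    cases hx
    exact ⟨a, (PMF.mem_support_uniformOfFinset_iff hs a).1 ha, rfl, rfl⟩
  refine ensures_bind _ _ ?_ ?_
  · intro c hc
    obtain ⟨a, -, ha, -⟩ := key _ _ hc
    cases ha
  · intro a c hc
    obtain ⟨b, hb, hab, rfl⟩ := key _ _ hc
    cases hab
    simpa using h a hb

/-- If an algorithm is cut off at level `f` only after at least `f` steps and its expected number
of steps is finite, then it terminates almost surely: by Markov's inequality, the cut-off
probability is at most `expectedSteps / f`. -/
theorem terminatesAlmostSurely_of_expectedSteps_lt_top {run : ℕ → RandM α}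
    (hrun : ∀ f, Ensures (run f) fun x c => x = none → f ≤ c)
    (hfin : expectedSteps run < ⊤) : TerminatesAlmostSurely run := by
  have hle : ∀ f : ℕ, (f : ℝ≥0∞) * ∑' c : ℕ, (run f).law (none, c) ≤ expectedSteps run := by
    intro f
    refine le_trans ?_ (le_iSup (fun f => ∑' x : Option α × ℕ, (run f).law x * (x.2 : ℝ≥0∞)) f)
    rw [← ENNReal.tsum_mul_left]
    calc ∑' c : ℕ, (f : ℝ≥0∞) * (run f).law (none, c)
        ≤ ∑' c : ℕ, (run f).law (none, c) * (c : ℝ≥0∞) := by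
          refine ENNReal.tsum_le_tsum fun c => ?_
          by_cases h : (run f).law (none, c) = 0
          · simp [h]
          · rw [mul_comm]
            gcongr
            exact hrun f none c h rfl
      _ ≤ ∑' x : Option α × ℕ, (run f).law x * (x.2 : ℝ≥0∞) :=
          ENNReal.tsum_comp_le_tsum_of_injective
            (f := fun c : ℕ => ((none : Option α), c))
            (fun a b h => by simpa using h)
            (fun x : Option α × ℕ => (run f).law x * (x.2 : ℝ≥0∞))
  have hlim : Filter.Tendsto (fun f : ℕ => expectedSteps run / (f : ℝ≥0∞)) Filter.atTop
      (nhds 0) := by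
    have := ENNReal.Tendsto.const_div (a := expectedSteps run) ENNReal.tendsto_nat_nhds_top
      (Or.inr hfin.ne)
    simpa using this
  refine tendsto_of_tendsto_of_tendsto_of_le_of_le' tendsto_const_nhds hlim
    (Filter.Eventually.of_forall fun _ => zero_le) ?_
  filter_upwards [Filter.eventually_gt_atTop 0] with f hf
  rw [ENNReal.le_div_iff_mul_le (Or.inl (by exact_mod_cast hf.ne')) (Or.inl (by simp)), mul_comm]
  exact hle f

end RandM

/-! ### Signs of rational functions to the left of `1` -/

section SignNearOne

open Polynomial Filter Topology

/-- `coreAtOne p` has the sign that `p` has immediately to the left of `1`, because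
`p = (1 - x) ^ c * q` with `q` continuous at `1`. -/
theorem eventually_sign_eval_eq (p : ℝ[X]) :
    ∀ᶠ x in 𝓝[<] (1 : ℝ), SignType.sign (p.eval x) = SignType.sign (coreAtOne p) := by
  by_cases hp : p = 0
  · simp [hp, coreAtOne]
  set c := p.rootMultiplicity 1 with hc
  set q := p /ₘ (X - C 1) ^ c with hq
  have hpq : (X - C 1) ^ c * q = p := pow_mul_divByMonic_rootMultiplicity_eq p 1
  have hq1 : q.eval 1 ≠ 0 := eval_divByMonic_pow_rootMultiplicity_ne_zero 1 hp
  have hqs : ∀ᶠ x in 𝓝[<] (1 : ℝ), SignType.sign (q.eval x) = SignType.sign (q.eval 1) := by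
    have hcont : Tendsto (fun x => q.eval x) (𝓝[<] (1 : ℝ)) (𝓝 (q.eval 1)) :=
      (q.continuous.tendsto 1).mono_left nhdsWithin_le_nhds
    rcases lt_or_gt_of_ne hq1 with h | h
    · filter_upwards [hcont.eventually_lt_const h] with x hx
      rw [sign_neg hx, sign_neg h]
    · filter_upwards [hcont.eventually_const_lt h] with x hx
      rw [sign_pos hx, sign_pos h]
  filter_upwards [hqs, self_mem_nhdsWithin] with x hx hx1
  have hx1' : SignType.sign (x - 1) = SignType.sign (-1 : ℝ) := by
    rw [sign_neg (sub_neg.2 hx1), sign_neg (by norm_num)]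
  have hcore : coreAtOne p = (-1) ^ c * q.eval 1 := rfl
  rw [hcore, ← hpq, eval_mul, eval_pow, eval_sub, eval_X, eval_C, sign_mul, sign_mul,
    sign_pow, sign_pow, hx1', hx]

theorem eventually_eval_ne_zero {p : ℝ[X]} (hp : p ≠ 0) :
    ∀ᶠ x in 𝓝[<] (1 : ℝ), p.eval x ≠ 0 := by
  have hfin : {x | p.eval x = 0}.Finite := by
    refine p.roots.toFinset.finite_toSet.subset fun x hx => ?_
    simpa [hp] using hx
  have h1 : ∀ᶠ x in 𝓝[≠] (1 : ℝ), x ∉ {x | p.eval x = 0} := by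
    have := (hfin.subset (Set.sdiff_subset (t := {1}))).isClosed.isOpen_compl.mem_nhds
      (x := (1 : ℝ)) (by simp)
    filter_upwards [mem_nhdsWithin_of_mem_nhds this, self_mem_nhdsWithin] with x hx hx1 h
    exact hx ⟨h, hx1⟩
  exact h1.filter_mono (nhdsWithin_mono _ fun x hx => ne_of_lt hx)

/-- `φ` agrees with the rational function `r` immediately to the left of `1`. -/
def AgreesNearOne (r : RatFunc ℝ) (φ : ℝ → ℝ) : Prop :=
  ∀ᶠ x in 𝓝[<] (1 : ℝ), φ x = r.eval (RingHom.id ℝ) x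

namespace AgreesNearOne

theorem eventually_denom (r : RatFunc ℝ) :
    ∀ᶠ x in 𝓝[<] (1 : ℝ), r.denom.eval₂ (RingHom.id ℝ) x ≠ 0 :=
  eventually_eval_ne_zero r.denom_ne_zero

theorem add {r₁ r₂ : RatFunc ℝ} {φ₁ φ₂ : ℝ → ℝ} (h₁ : AgreesNearOne r₁ φ₁)
    (h₂ : AgreesNearOne r₂ φ₂) : AgreesNearOne (r₁ + r₂) (fun x => φ₁ x + φ₂ x) := by
  filter_upwards [h₁, h₂, eventually_denom r₁, eventually_denom r₂] with x e₁ e₂ d₁ d₂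
  rw [RatFunc.eval_add _ _ d₁ d₂, e₁, e₂]

theorem mul {r₁ r₂ : RatFunc ℝ} {φ₁ φ₂ : ℝ → ℝ} (h₁ : AgreesNearOne r₁ φ₁)
    (h₂ : AgreesNearOne r₂ φ₂) : AgreesNearOne (r₁ * r₂) (fun x => φ₁ x * φ₂ x) := by
  filter_upwards [h₁, h₂, eventually_denom r₁, eventually_denom r₂] with x e₁ e₂ d₁ d₂
  rw [RatFunc.eval_mul _ _ d₁ d₂, e₁, e₂]

theorem const (c : ℝ) : AgreesNearOne (RatFunc.C c) (fun _ => c) :=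
  Eventually.of_forall fun x => by simp

theorem id : AgreesNearOne RatFunc.X (fun x => x) :=
  Eventually.of_forall fun x => by simp

theorem polynomial (p : ℝ[X]) : AgreesNearOne (algebraMap ℝ[X] (RatFunc ℝ) p) (fun x => p.eval x) :=
  Eventually.of_forall fun x => by
    rw [RatFunc.eval_algebraMap]
    simp [Polynomial.eval₂_id]

theorem sub {r₁ r₂ : RatFunc ℝ} {φ₁ φ₂ : ℝ → ℝ} (h₁ : AgreesNearOne r₁ φ₁)
    (h₂ : AgreesNearOne r₂ φ₂) : AgreesNearOne (r₁ - r₂) (fun x => φ₁ x - φ₂ x) := by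
  have := h₁.add ((const (-1)).mul h₂)
  simpa [sub_eq_add_neg] using this

theorem sum {ι : Type*} (s : Finset ι) {r : ι → RatFunc ℝ} {φ : ι → ℝ → ℝ}
    (h : ∀ i, AgreesNearOne (r i) (φ i)) :
    AgreesNearOne (∑ i ∈ s, r i) (fun x => ∑ i ∈ s, φ i x) := by
  classical
  induction s using Finset.induction_on with
  | empty => simpa using const 0
  | insert i s hi ih => simpa only [Finset.sum_insert hi] using (h i).add ih

/-- A quotient of polynomials, given as the solution `φ` of `q * φ = p`. -/
theorem div {p q : ℝ[X]} (hq : q ≠ 0) {φ : ℝ → ℝ}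
    (h : ∀ᶠ x in 𝓝[<] (1 : ℝ), q.eval x * φ x = p.eval x) :
    AgreesNearOne (algebraMap ℝ[X] (RatFunc ℝ) p / algebraMap ℝ[X] (RatFunc ℝ) q) φ := by
  set r : RatFunc ℝ := algebraMap ℝ[X] (RatFunc ℝ) p / algebraMap ℝ[X] (RatFunc ℝ) q
  have hr : algebraMap ℝ[X] (RatFunc ℝ) q * r = algebraMap ℝ[X] (RatFunc ℝ) p :=
    mul_div_cancel₀ _ (by simpa using hq)
  have h1 : AgreesNearOne (algebraMap ℝ[X] (RatFunc ℝ) q * r)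
      (fun x => q.eval x * r.eval (RingHom.id ℝ) x) :=
    (polynomial q).mul (Eventually.of_forall fun _ => rfl)
  rw [hr] at h1
  filter_upwards [h, h1, polynomial p, eventually_eval_ne_zero hq] with x e₁ e₂ e₃ hx
  exact mul_left_cancel₀ hx (by rw [e₁, e₂, e₃])

/-- The `μ`-ordering compares rational functions immediately to the left of `1`. -/
theorem muGT_iff {r : RatFunc ℝ} {φ : ℝ → ℝ} (h : AgreesNearOne r φ) :
    ∀ᶠ x in 𝓝[<] (1 : ℝ), (muGT r 0 ↔ 0 < φ x) := by
  filter_upwards [h, eventually_sign_eval_eq r.num, eventually_sign_eval_eq r.denom]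
    with x e hn hd
  rw [muGT, sub_zero, e, RatFunc.eval, Polynomial.eval₂_id, Polynomial.eval₂_id,
    ← sign_eq_one_iff, sign_mul, ← hn, ← hd, ← sign_mul, sign_eq_one_iff, div_eq_mul_inv]
  rcases lt_trichotomy (r.denom.eval x) 0 with hx | hx | hx
  · simp only [mul_pos_iff, hx, hx.not_gt, inv_lt_zero, inv_pos]
  · simp [hx]
  · rw [mul_pos_iff_of_pos_right hx, mul_pos_iff_of_pos_right (inv_pos.2 hx)]

end AgreesNearOne

end SignNearOne

/-! ### Values of policies at a fixed discount factor -/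

namespace MDP

variable {S : Type u} {A : Type v} [Fintype S]

theorem abs_sum_mul_le (M : MDP S A) (s : S) (a : A) {u : S → ℝ} {b : ℝ}
    (hu : ∀ s, |u s| ≤ b) : |∑ s', M.T s a s' * u s'| ≤ b := by
  calc |∑ s', M.T s a s' * u s'| ≤ ∑ s', |M.T s a s' * u s'| := Finset.abs_sum_le_sum_abs _ _
    _ ≤ ∑ s', M.T s a s' * b := by
        gcongr with s' _
        rw [abs_mul, abs_of_nonneg (M.T_nonneg _ _ _)]
        exact mul_le_mul_of_nonneg_left (hu s') (M.T_nonneg _ _ _)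
    _ = b := by rw [← Finset.sum_mul, M.T_sum, one_mul]

/-- A supersolution of the homogeneous Bellman equation is nonnegative: look at a state where it
is smallest. -/
theorem nonneg_of_discounted_sum_le (M : MDP S A) {γ : ℝ} (h0 : 0 ≤ γ) (h1 : γ < 1)
    (σ : Policy S A) {δ : S → ℝ} (h : ∀ s, γ * ∑ s', M.T s (σ s) s' * δ s' ≤ δ s) (s : S) :
    0 ≤ δ s := by
  obtain ⟨s₀, -, hmin⟩ := Finset.exists_min_image Finset.univ δ ⟨s, Finset.mem_univ s⟩
  have hle : δ s₀ ≤ ∑ s', M.T s₀ (σ s₀) s' * δ s' := by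
    calc δ s₀ = ∑ s', M.T s₀ (σ s₀) s' * δ s₀ := by rw [← Finset.sum_mul, M.T_sum, one_mul]
      _ ≤ _ := by
        gcongr with s' hs'
        · exact M.T_nonneg _ _ _
        · exact hmin s' hs'
  have h2 := h s₀
  have h3 : 0 ≤ δ s₀ := by nlinarith
  exact h3.trans (hmin s (Finset.mem_univ s))

variable [DecidableEq S]

/-- The action value `Q^π_γ(s, a)` at the discount factor `γ`. -/
noncomputable def qValue (M : MDP S A) (γ : ℝ) (π : Policy S A) (s : S) (a : A) : ℝ :=
  M.R s a + γ * ∑ s', M.T s a s' * M.value γ π s'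

theorem value_eq_qValue (M : MDP S A) {γ : ℝ} (h0 : 0 ≤ γ) (h1 : γ < 1) (π : Policy S A) (s : S) :
    M.value γ π s = M.qValue γ π s (π s) := by
  set w : ℕ → S → ℝ := fun t => (M.transMatrix π ^ t).mulVec (M.rewardVec π) with hw
  have hstep : ∀ t s, w (t + 1) s = ∑ s', M.T s (π s) s' * w t s' := by
    intro t s
    simp only [hw, pow_succ', ← Matrix.mulVec_mulVec]
    rfl
  obtain ⟨b, hb⟩ : ∃ b, ∀ s, |w 0 s| ≤ b := by
    refine ⟨∑ s, |w 0 s|, fun s => ?_⟩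
    exact Finset.single_le_sum (f := fun s => |w 0 s|) (fun _ _ => abs_nonneg _)
      (Finset.mem_univ s)
  have hbound : ∀ t s, |w t s| ≤ b := by
    intro t
    induction t with
    | zero => exact hb
    | succ t ih =>
      intro s
      rw [hstep]
      exact M.abs_sum_mul_le s (π s) ih
  have hsum : ∀ s, Summable fun t : ℕ => γ ^ t * w t s := by
    intro s
    refine Summable.of_norm_bounded ((summable_geometric_of_lt_one h0 h1).mul_right b) fun t => ?_
    rw [Real.norm_eq_abs, abs_mul, abs_of_nonneg (pow_nonneg h0 t)]
    exact mul_le_mul_of_nonneg_left (hbound t s) (pow_nonneg h0 t)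
  change ∑' t, γ ^ t * w t s = M.R s (π s) + γ * ∑ s', M.T s (π s) s' * ∑' t, γ ^ t * w t s'
  rw [(hsum s).tsum_eq_zero_add]
  have h0' : γ ^ 0 * w 0 s = M.R s (π s) := by simp [hw, rewardVec]
  rw [h0']
  congr 1
  simp only [← tsum_mul_left]
  rw [← Summable.tsum_finsetSum fun s' _ => (hsum s').mul_left _, ← tsum_mul_left]
  refine tsum_congr fun t => ?_
  rw [hstep, pow_succ', mul_assoc, Finset.mul_sum]
  congr 1
  exact Finset.sum_congr rfl fun s' _ => by ring

/-- If `u` dominates its own one-step update under `σ`, then it dominates the value of `σ`. -/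
theorem value_le_of_supersolution (M : MDP S A) {γ : ℝ} (h0 : 0 ≤ γ) (h1 : γ < 1)
    (σ : Policy S A) {u : S → ℝ}
    (h : ∀ s, M.R s (σ s) + γ * ∑ s', M.T s (σ s) s' * u s' ≤ u s) (s : S) :
    M.value γ σ s ≤ u s := by
  refine sub_nonneg.1 (M.nonneg_of_discounted_sum_le h0 h1 σ (δ := fun s => u s - M.value γ σ s)
    (fun s => ?_) s)
  have h2 := M.value_eq_qValue h0 h1 σ s
  rw [qValue] at h2
  simp only [mul_sub, Finset.sum_sub_distrib]
  linarith [h s]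

theorem le_value_of_subsolution (M : MDP S A) {γ : ℝ} (h0 : 0 ≤ γ) (h1 : γ < 1)
    (σ : Policy S A) {u : S → ℝ}
    (h : ∀ s, u s ≤ M.R s (σ s) + γ * ∑ s', M.T s (σ s) s' * u s') (s : S) :
    u s ≤ M.value γ σ s := by
  refine sub_nonneg.1 (M.nonneg_of_discounted_sum_le h0 h1 σ (δ := fun s => M.value γ σ s - u s)
    (fun s => ?_) s)
  have h2 := M.value_eq_qValue h0 h1 σ s
  rw [qValue] at h2
  simp only [mul_sub, Finset.sum_sub_distrib]
  linarith [h s]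

/-! ### Cramer's rule and the sign test -/

theorem eval_bellmanMatrix (M : MDP S A) (π : Policy S A) (γ : ℝ) :
    (M.bellmanMatrix π).map (Polynomial.eval γ) = 1 - γ • M.transMatrix π := by
  ext s s'
  by_cases h : s = s' <;> simp [bellmanMatrix, h, mul_comm γ]

theorem bellman_mulVec (M : MDP S A) (π : Policy S A) (γ : ℝ) (u : S → ℝ) (s : S) :
    (1 - γ • M.transMatrix π).mulVec u s = u s - γ * ∑ s', M.T s (π s) s' * u s' := by
  rw [Matrix.sub_mulVec, Matrix.one_mulVec, Matrix.smul_mulVec]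
  rfl

theorem det_bellman_ne_zero (M : MDP S A) {γ : ℝ} (h0 : 0 ≤ γ) (h1 : γ < 1) (π : Policy S A) :
    (1 - γ • M.transMatrix π).det ≠ 0 := by
  intro hdet
  obtain ⟨u, hu, hu0⟩ := Matrix.exists_mulVec_eq_zero_iff.2 hdet
  have key : ∀ s, u s = γ * ∑ s', M.T s (π s) s' * u s' := by
    intro s
    have := congrFun hu0 s
    rw [bellman_mulVec] at this
    simpa [sub_eq_zero] using this
  refine hu (funext fun s => le_antisymm ?_ ?_)
  · have := M.nonneg_of_discounted_sum_le h0 h1 π (δ := fun s => -u s)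
      (fun s => by simp only [mul_neg, Finset.sum_neg_distrib]; linarith [key s]) s
    simpa using this
  · exact M.nonneg_of_discounted_sum_le h0 h1 π (fun s => (key s).ge) s

theorem det_mul_value (M : MDP S A) {γ : ℝ} (h0 : 0 ≤ γ) (h1 : γ < 1) (π : Policy S A) (s : S) :
    (1 - γ • M.transMatrix π).det * M.value γ π s =
      ((1 - γ • M.transMatrix π).updateCol s (M.rewardVec π)).det := by
  set B := 1 - γ • M.transMatrix π with hB
  have hval : B.mulVec (M.value γ π) = M.rewardVec π := by
    funext s
    rw [bellman_mulVec, M.value_eq_qValue h0 h1 π s, qValue, rewardVec]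
    ring
  rw [← Matrix.cramer_apply, ← hval, Matrix.cramer_eq_adjugate_mulVec, Matrix.mulVec_mulVec,
    Matrix.adjugate_mul, Matrix.smul_mulVec, Matrix.one_mulVec]
  rfl

theorem eval_det_bellmanMatrix (M : MDP S A) (π : Policy S A) (γ : ℝ) :
    (M.bellmanMatrix π).det.eval γ = (1 - γ • M.transMatrix π).det := by
  rw [← eval_bellmanMatrix, ← Polynomial.coe_evalRingHom, RingHom.map_det]
  rfl

theorem valueRat_agreesNearOne (M : MDP S A) (π : Policy S A) (s : S) :
    AgreesNearOne (M.valueRat π s) (fun γ => M.value γ π s) := by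
  refine AgreesNearOne.div ?_ ?_
  · intro h
    have h2 := M.det_bellman_ne_zero le_rfl one_pos π
    rw [← eval_det_bellmanMatrix, h] at h2
    simp at h2
  · filter_upwards [Ioo_mem_nhdsLT (zero_lt_one' ℝ)] with γ hγ
    rw [eval_det_bellmanMatrix, M.det_mul_value hγ.1.le hγ.2, ← Polynomial.coe_evalRingHom,
      RingHom.map_det, ← eval_bellmanMatrix]
    congr 1
    ext i j
    by_cases h : j = s <;> simp [h]

theorem gainRat_agreesNearOne (M : MDP S A) (π : Policy S A) (p : S × A) :
    AgreesNearOne (M.gainRat π p) (fun γ => M.qValue γ π p.1 p.2 - M.value γ π p.1) := by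
  refine AgreesNearOne.sub ((AgreesNearOne.const _).add (AgreesNearOne.id.mul
    (AgreesNearOne.sum _ fun s' => (AgreesNearOne.const _).mul ?_))) ?_
  · exact M.valueRat_agreesNearOne π s'
  · exact M.valueRat_agreesNearOne π p.1

/-- For all discount factors close enough to `1`, the sign test of the algorithm is the comparison
of the values at that discount factor. -/
theorem exists_discount_improving_iff [Finite A] (M : MDP S A) :
    ∃ γ' : ℝ, 0 ≤ γ' ∧ γ' < 1 ∧ ∀ γ : ℝ, γ' ≤ γ → γ < 1 → ∀ (π : Policy S A) (p : S × A),
      (M.Improving π p ↔ M.value γ π p.1 < M.qValue γ π p.1 p.2) := by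
  have h : ∀ᶠ γ in nhdsWithin (1 : ℝ) (Set.Iio 1), ∀ (π : Policy S A) (p : S × A),
      (M.Improving π p ↔ M.value γ π p.1 < M.qValue γ π p.1 p.2) := by
    refine Filter.eventually_all.2 fun π => Filter.eventually_all.2 fun p => ?_
    filter_upwards [(M.gainRat_agreesNearOne π p).muGT_iff] with γ hγ
    rw [Improving, hγ, sub_pos]
  obtain ⟨l, hl, hsub⟩ := (mem_nhdsLT_iff_exists_Ioo_subset (a := (1 : ℝ))).1 h
  have hl1 : l < 1 := hl
  refine ⟨max 0 ((l + 1) / 2), le_max_left _ _, max_lt one_pos (by linarith), fun γ h1 h2 => ?_⟩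
  have := (le_max_right 0 ((l + 1) / 2)).trans h1
  exact hsub ⟨by linarith, h2⟩

theorem isBlackwellOptimal_of_not_improving (M : MDP S A) {γ' : ℝ} (h0 : 0 ≤ γ') (h1 : γ' < 1)
    (himp : ∀ γ : ℝ, γ' ≤ γ → γ < 1 → ∀ (π : Policy S A) (p : S × A),
      (M.Improving π p ↔ M.value γ π p.1 < M.qValue γ π p.1 p.2))
    {π : Policy S A} (hπ : ∀ p, ¬ M.Improving π p) : M.IsBlackwellOptimal π := by
  refine ⟨γ', h0, h1, fun γ hγ hγ1 σ => ?_⟩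
  refine M.value_le_of_supersolution (h0.trans hγ) hγ1 σ fun s => ?_
  have := hπ (s, σ s)
  rw [himp γ hγ hγ1, not_lt] at this
  exact this

end MDP

/-! ### A scalar objective that the algorithm improves -/

namespace MDP

variable {S : Type u} {A : Type v} [Fintype S] [DecidableEq S] [DecidableEq A]

theorem mem_pairs {π : Policy S A} {p : S × A} : p ∈ pairs π ↔ π p.1 = p.2 := by
  rcases p with ⟨s, a⟩
  simp [pairs]

theorem pair_mem_pairs (π : Policy S A) (s : S) : (s, π s) ∈ pairs π := mem_pairs.2 rfl

theorem card_pairs (π : Policy S A) : (pairs π).card = Fintype.card S :=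
  Finset.card_image_of_injective _ fun _ _ h => congrArg Prod.fst h

theorem pairs_switch_subset {G : Finset (S × A)} {π : Policy S A} {p : S × A} (hp : p ∈ G)
    (hπ : pairs π ⊆ G) : pairs (switch p π) ⊆ G := by
  intro q hq
  rw [mem_pairs, switch, Function.update_apply] at hq
  split_ifs at hq with h
  · have : q = p := Prod.ext h hq.symm
    rwa [this]
  · exact hπ (mem_pairs.2 hq)

/-- `Val` is a scalar objective compatible with the sign test: improving switches increase it, a
policy without improving pairs in `G` maximises it among the policies inside `G`, and the
improving pairs of such a policy depend on `G` only. -/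
structure IsObjective (M : MDP S A) (Val : Policy S A → ℝ) : Prop where
  lt_switch : ∀ π p, M.Improving π p → Val π < Val (switch p π)
  le_of_not_improving : ∀ (G : Finset (S × A)) (π σ : Policy S A),
    (∀ p ∈ G, ¬ M.Improving π p) → pairs σ ⊆ G → Val σ ≤ Val π
  improving_congr : ∀ (G : Finset (S × A)) (π σ : Policy S A), pairs π ⊆ G → pairs σ ⊆ G →
    (∀ p ∈ G, ¬ M.Improving π p) → (∀ p ∈ G, ¬ M.Improving σ p) →
    ∀ p, (M.Improving π p ↔ M.Improving σ p)

/-- The sum of the values at a discount factor where the sign test compares values is an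
objective. -/
theorem isObjective_sum_value (M : MDP S A) {γ : ℝ} (h0 : 0 ≤ γ) (h1 : γ < 1)
    (himp : ∀ (π : Policy S A) (p : S × A),
      (M.Improving π p ↔ M.value γ π p.1 < M.qValue γ π p.1 p.2)) :
    M.IsObjective fun π => ∑ s, M.value γ π s := by
  have hopt : ∀ (G : Finset (S × A)) (π σ : Policy S A),
      (∀ p ∈ G, ¬ M.Improving π p) → pairs σ ⊆ G → ∀ s, M.value γ σ s ≤ M.value γ π s := by
    intro G π σ hG hσ
    refine M.value_le_of_supersolution h0 h1 σ fun s => ?_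
    have := hG (s, σ s) (hσ (pair_mem_pairs σ s))
    rw [himp, not_lt] at this
    exact this
  refine ⟨fun π p hp => ?_, fun G π σ hG hσ => Finset.sum_le_sum fun s _ => hopt G π σ hG hσ s,
    fun G π σ hπ hσ hGπ hGσ p => ?_⟩
  · rw [himp] at hp
    have hsub : ∀ s, M.value γ π s ≤ M.qValue γ π s (switch p π s) := by
      intro s
      by_cases hs : s = p.1
      · subst hs
        simpa [switch] using hp.le
      · simpa [switch, hs] using (M.value_eq_qValue h0 h1 π s).le
    have hle : ∀ s, M.value γ π s ≤ M.value γ (switch p π) s :=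
      M.le_value_of_subsolution h0 h1 _ hsub
    refine Finset.sum_lt_sum (fun s _ => hle s) ⟨p.1, Finset.mem_univ _, hp.trans_le ?_⟩
    rw [M.value_eq_qValue h0 h1 (switch p π)]
    simp only [qValue, switch, Function.update_self]
    gcongr with s' _
    · exact M.T_nonneg _ _ _
    · exact hle s'
  · have heq : M.value γ π = M.value γ σ :=
      funext fun s => le_antisymm (hopt G σ π hGσ hπ s) (hopt G π σ hGπ hσ s)
    rw [himp, himp, qValue, qValue, heq]

theorem exists_max_objective [Fintype A] (Val : Policy S A → ℝ) {G : Finset (S × A)}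
    {π : Policy S A} (hπ : pairs π ⊆ G) :
    ∃ σ, pairs σ ⊆ G ∧ ∀ τ, pairs τ ⊆ G → Val τ ≤ Val σ := by
  obtain ⟨σ, hσ, hmax⟩ := Finset.exists_max_image
    (Finset.univ.filter fun σ : Policy S A => pairs σ ⊆ G) Val ⟨π, by simpa using hπ⟩
  exact ⟨σ, by simpa using hσ, fun τ hτ => hmax τ (by simpa using hτ)⟩

namespace IsObjective

variable {M : MDP S A} {Val : Policy S A → ℝ}

theorem not_improving_of_mem_pairs (hV : M.IsObjective Val) {π : Policy S A} {p : S × A}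
    (hp : p ∈ pairs π) : ¬ M.Improving π p := by
  intro h
  have := hV.lt_switch π p h
  rw [mem_pairs] at hp
  rw [switch, ← hp, Function.update_eq_self] at this
  exact lt_irrefl _ this

theorem exists_not_improving [Fintype A] (hV : M.IsObjective Val) {G : Finset (S × A)}
    {π : Policy S A} (hπ : pairs π ⊆ G) :
    ∃ σ, pairs σ ⊆ G ∧ ∀ p ∈ G, ¬ M.Improving σ p := by
  obtain ⟨σ, hσ, hmax⟩ := exists_max_objective Val hπ
  exact ⟨σ, hσ, fun p hp himp =>
    (hV.lt_switch σ p himp).not_ge (hmax _ (pairs_switch_subset hp hσ))⟩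

theorem sdiff_pairs_nonempty (hV : M.IsObjective Val) {G : Finset (S × A)} {π : Policy S A}
    (h : ¬ ∀ p ∈ G, ¬ M.Improving π p) : (G \ pairs π).Nonempty := by
  push Not at h
  obtain ⟨p, hp, himp⟩ := h
  exact ⟨p, Finset.mem_sdiff.2 ⟨hp, fun h => hV.not_improving_of_mem_pairs h himp⟩⟩

end IsObjective

/-! ### Results and cut-offs of Random-Facet-Blackwell -/

open Classical in
theorem randomFacet_succ (M : MDP S A) (f : ℕ) (G : Finset (S × A)) (π : Policy S A) :
    M.randomFacet (f + 1) G π =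
      (RandM.tick (1 + G.card) >>= fun _ =>
        if ∀ p ∈ G, ¬ M.Improving π p then pure π
        else RandM.uniformFrom (G \ pairs π) >>= fun p =>
          M.randomFacet f (G.erase p) π >>= fun π' =>
            RandM.tick 1 >>= fun _ =>
              if M.Improving π' p then M.randomFacet f G (switch p π') else pure π') := by
  rw [randomFacet]

theorem pairs_subset_erase {G : Finset (S × A)} {π : Policy S A} (hπ : pairs π ⊆ G) {p : S × A}
    (hp : p ∈ G \ pairs π) : pairs π ⊆ G.erase p := fun _ hq =>
  Finset.mem_erase.2 ⟨fun h => (Finset.mem_sdiff.1 hp).2 (h ▸ hq), hπ hq⟩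

/-- Random-Facet-Blackwell returns policies inside `G` that no pair of `G` improves, and is cut off
at depth `f` only after `f` steps. -/
theorem ensures_randomFacet {M : MDP S A} {Val : Policy S A → ℝ} (hV : M.IsObjective Val) (f : ℕ) :
    ∀ (G : Finset (S × A)) (π : Policy S A), pairs π ⊆ G →
      RandM.Ensures (M.randomFacet f G π) fun x c => (x = none → f ≤ c) ∧
        ∀ σ, x = some σ → pairs σ ⊆ G ∧ ∀ p ∈ G, ¬ M.Improving σ p := by
  induction f with
  | zero =>
    intro G π _
    rw [randomFacet]
    exact RandM.ensures_abort ⟨fun _ => le_rfl, by simp⟩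
  | succ f ih =>
    intro G π hπ
    rw [randomFacet_succ]
    refine RandM.ensures_tick_bind _ _ ?_
    split_ifs with hopt
    · exact RandM.ensures_pure _ ⟨by simp, fun σ hσ => by cases hσ; exact ⟨hπ, hopt⟩⟩
    refine RandM.ensures_uniformFrom_bind _ (hV.sdiff_pairs_nonempty hopt) _ fun p hp => ?_
    have hpG : p ∈ G := (Finset.mem_sdiff.1 hp).1
    refine RandM.ensures_bind _ _ ?_ ?_
    · intro c hc
      refine ⟨fun _ => ?_, by simp⟩
      have := (ih _ _ (pairs_subset_erase hπ hp) _ _ hc).1 rfl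
      omega
    · intro π' c hc
      obtain ⟨hsub, hni⟩ := (ih _ _ (pairs_subset_erase hπ hp) _ _ hc).2 π' rfl
      have hsub' : pairs π' ⊆ G := hsub.trans (Finset.erase_subset _ _)
      refine RandM.ensures_tick_bind _ _ ?_
      split_ifs with himp
      · intro x c' hx
        have := ih _ _ (pairs_switch_subset hpG hsub') x c' hx
        exact ⟨fun hn => by have := this.1 hn; omega, this.2⟩
      · refine RandM.ensures_pure _ ⟨by simp, fun σ hσ => ?_⟩
        cases hσ
        refine ⟨hsub', fun q hq => ?_⟩
        by_cases hqp : q = p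
        · rwa [hqp]
        · exact hni q (Finset.mem_erase.2 ⟨hqp, hq⟩)

/-! ### The expected number of steps of Random-Facet-Blackwell -/

open Classical in
/-- The pairs of `π` that occur in all policies inside `G` that are at least as good as `π`.
The number of remaining states is the hidden dimension of the pair `(G, π)`. -/
noncomputable def enforced (Val : Policy S A → ℝ) (G : Finset (S × A)) (π : Policy S A) :
    Finset (S × A) :=
  (pairs π).filter fun p => ∀ σ, pairs σ ⊆ G → Val π ≤ Val σ → p ∈ pairs σ

theorem mem_enforced {Val : Policy S A → ℝ} {G : Finset (S × A)} {π : Policy S A} {p : S × A} :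
    p ∈ enforced Val G π ↔
      p ∈ pairs π ∧ ∀ σ, pairs σ ⊆ G → Val π ≤ Val σ → p ∈ pairs σ := by
  simp only [enforced, Finset.mem_filter]

theorem enforced_subset (Val : Policy S A → ℝ) (G : Finset (S × A)) (π : Policy S A) :
    enforced Val G π ⊆ pairs π := fun _ hp => (mem_enforced.1 hp).1

theorem enforced_mono {Val : Policy S A → ℝ} {G G' : Finset (S × A)} {π π' : Policy S A}
    (hG : G' ⊆ G) (hπ' : pairs π' ⊆ G') (h : Val π ≤ Val π') :
    enforced Val G π ⊆ enforced Val G' π' := by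
  intro p hp
  have hp2 := (mem_enforced.1 hp).2
  exact mem_enforced.2 ⟨hp2 π' (hπ'.trans hG) h,
    fun σ hσ hle => hp2 σ (hσ.trans hG) (h.trans hle)⟩

/-- Let `W q` be the optimum without `q`. A policy that is better than `W p` enforces all `q` with
`W q ≤ W p`. -/
theorem card_enforced_add_rank_le {Val : Policy S A → ℝ} {G : Finset (S × A)} {π π' : Policy S A}
    (hπ : pairs π ⊆ G) (hπ' : pairs π' ⊆ G) {W : S × A → ℝ}
    (hW : ∀ q ∈ G \ pairs π, ∀ τ, pairs τ ⊆ G.erase q → Val τ ≤ W q) {p : S × A}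
    (hp : p ∈ G \ pairs π) (hlt : W p < Val π') :
    (enforced Val G π).card + ((G \ pairs π).filter fun q => W q ≤ W p).card ≤
      (enforced Val G π').card := by
  rw [← Finset.card_union_of_disjoint]
  · refine Finset.card_le_card (Finset.union_subset ?_ ?_)
    · exact enforced_mono (Finset.Subset.refl G) hπ'
        ((hW p hp π (pairs_subset_erase hπ hp)).trans hlt.le)
    · intro q hq
      obtain ⟨hq, hle⟩ := Finset.mem_filter.1 hq
      have key : ∀ σ, pairs σ ⊆ G → Val π' ≤ Val σ → q ∈ pairs σ := by
        intro σ hσ hσ'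
        by_contra hmem
        have := hW q hq σ fun x hx => Finset.mem_erase.2 ⟨fun h => hmem (h ▸ hx), hσ hx⟩
        linarith
      exact mem_enforced.2 ⟨key π' hπ' le_rfl, key⟩
  · refine Finset.disjoint_left.2 fun q hq hq' => ?_
    exact (Finset.mem_sdiff.1 (Finset.mem_filter.1 hq').1).2 (enforced_subset _ _ _ hq)

end MDP

/-- The ranks of the elements of `H` with respect to `W` are at least `1, …, |H|`. -/
theorem sum_pow_rank_le {ι : Type*} (H : Finset ι) (W : ι → ℝ) {x : ℝ} (hx0 : 0 ≤ x)
    (hx1 : x ≤ 1) :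
    ∑ p ∈ H, x ^ (H.filter fun q => W q ≤ W p).card ≤ ∑ i ∈ Finset.range H.card, x ^ (i + 1) := by
  classical
  induction H using Finset.induction_on_max_value W with
  | empty => simp
  | insert a s ha hmax ih =>
    rw [Finset.sum_insert ha, Finset.card_insert_of_notMem ha, Finset.sum_range_succ, add_comm]
    refine add_le_add (le_trans (Finset.sum_le_sum fun p _ => ?_) ih) (le_of_eq ?_)
    · exact pow_le_pow_of_le_one hx0 hx1 (Finset.card_le_card
        (Finset.filter_subset_filter _ (Finset.subset_insert _ _)))
    · rw [Finset.filter_true_of_mem, Finset.card_insert_of_notMem ha]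
      intro q hq
      rcases Finset.mem_insert.1 hq with rfl | hq
      · exact le_rfl
      · exact hmax q hq

/-- The growth of the bound for Random-Facet-Blackwell in the number `m` of pairs outside the
current policy; `r` is a parameter to be optimised. Up to the factor `m + 1`, it is the product over
`j ≤ m` of `r + 1` for `j ≤ r` and of `j / (j - r)` for `j > r`, which are the factors that solve the
recursion when the hidden dimension is weighted by `(1 + 1 / r) ^ d`. -/
noncomputable def facetFactor (r m : ℕ) : ℝ :=
  if m ≤ r then ((r : ℝ) + 1) ^ m * (m + 1) else ((r : ℝ) + 1) ^ r * (m + 1) * m.choose r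

theorem facetFactor_of_ge {r m : ℕ} (h : r ≤ m) :
    facetFactor r m = ((r : ℝ) + 1) ^ r * (m + 1) * m.choose r := by
  rw [facetFactor]
  split_ifs with h'
  · obtain rfl := le_antisymm h h'
    simp
  · rfl

theorem one_le_facetFactor (r m : ℕ) : 1 ≤ facetFactor r m := by
  have h1 : ∀ k : ℕ, (1 : ℝ) ≤ ((r : ℝ) + 1) ^ k := fun k => one_le_pow₀ (by simp)
  have h2 : (1 : ℝ) ≤ m + 1 := by simp
  rw [facetFactor]
  split_ifs with h
  · exact one_le_mul_of_one_le_of_one_le (h1 m) h2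
  · refine one_le_mul_of_one_le_of_one_le (one_le_mul_of_one_le_of_one_le (h1 r) h2) ?_
    exact_mod_cast Nat.choose_pos (not_le.1 h).le

/-- The step in `m` of the recursion for Random-Facet-Blackwell, multiplied by `m + 1`. -/
theorem facetFactor_succ {r : ℕ} (hr : 1 ≤ r) (m : ℕ) :
    (m + 1) * (facetFactor r m + 1) +
        facetFactor r (m + 1) * ∑ i ∈ Finset.range (m + 1), ((r : ℝ) / (r + 1)) ^ (i + 1) ≤
      (m + 1) * facetFactor r (m + 1) := by
  have hr0 : (0 : ℝ) < r := by exact_mod_cast hr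
  set x : ℝ := (r : ℝ) / (r + 1) with hx
  have hx0 : 0 ≤ x := by positivity
  have hx1 : x < 1 := by rw [hx, div_lt_one (by positivity)]; linarith
  have hK := one_le_facetFactor r (m + 1)
  rcases le_or_gt (m + 1) r with h | h
  · -- Each of the `m + 1` summands is at most `x = 1 - 1 / (r + 1)`.
    have hsum : ∑ i ∈ Finset.range (m + 1), x ^ (i + 1) ≤ (m + 1) * x := by
      calc _ ≤ ∑ i ∈ Finset.range (m + 1), x := Finset.sum_le_sum fun i _ =>
            pow_le_of_le_one hx0 hx1.le (Nat.succ_ne_zero i)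
        _ = _ := by simp
    have h1 : facetFactor r m = ((r : ℝ) + 1) ^ m * (m + 1) := if_pos (by omega)
    have h2 : facetFactor r (m + 1) = ((r : ℝ) + 1) ^ (m + 1) * (m + 2) := by
      rw [facetFactor, if_pos h]
      push_cast
      ring
    have h3 : facetFactor r (m + 1) * x = facetFactor r (m + 1) - ((r : ℝ) + 1) ^ m * (m + 2) := by
      rw [h2, hx]
      field_simp
      ring
    have h4 : (1 : ℝ) ≤ ((r : ℝ) + 1) ^ m := one_le_pow₀ (by linarith)
    calc _ ≤ (m + 1) * (facetFactor r m + 1) + facetFactor r (m + 1) * ((m + 1) * x) := by gcongr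
      _ = (m + 1) * (facetFactor r m + 1 + facetFactor r (m + 1) * x) := by ring
      _ ≤ _ := by
        gcongr
        rw [h3, h1]
        linarith
  · -- The whole geometric series has sum `r`.
    have hsum : ∑ i ∈ Finset.range (m + 1), x ^ (i + 1) ≤ r := by
      have hgeom : (∑ i ∈ Finset.range (m + 1), x ^ i) * (1 - x) ≤ 1 := by
        rw [geom_sum_mul_neg]
        linarith [pow_nonneg hx0 (m + 1)]
      have h1x : 1 - x = 1 / (r + 1) := by rw [hx]; field_simp; ring
      rw [h1x, mul_one_div, div_le_one (by positivity)] at hgeom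
      simp only [pow_succ]
      rw [← Finset.sum_mul, hx, mul_div_assoc', div_le_iff₀ (by positivity)]
      nlinarith
    have h1 := facetFactor_of_ge (r := r) (m := m) (by omega)
    have h2 := facetFactor_of_ge (r := r) (m := m + 1) (by omega)
    have hch : ((m.choose r : ℕ) : ℝ) * (m + 1) = ((m + 1).choose r : ℕ) * ((m : ℝ) + 1 - r) := by
      have := Nat.choose_mul_succ_eq m r
      have h3 : ((m + 1 - r : ℕ) : ℝ) = (m : ℝ) + 1 - r := by
        rw [Nat.cast_sub h.le]
        push_cast
        ring
      rw [← h3]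
      exact_mod_cast this
    have h3 : facetFactor r (m + 1) * ((m : ℝ) + 1 - r) =
        ((r : ℝ) + 1) ^ r * (m + 2) * (m.choose r * (m + 1)) := by
      rw [h2, hch]
      push_cast
      ring
    have h4 : (1 : ℝ) ≤ ((r : ℝ) + 1) ^ r * m.choose r := by
      refine one_le_mul_of_one_le_of_one_le (one_le_pow₀ (by linarith)) ?_
      exact_mod_cast Nat.choose_pos (by omega)
    calc _ ≤ (m + 1) * (facetFactor r m + 1) + facetFactor r (m + 1) * r := by gcongr
      _ = (m + 1) * (((r : ℝ) + 1) ^ r * m.choose r * (m + 1) + 1) +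
          facetFactor r (m + 1) * r := by rw [h1]; ring
      _ ≤ (m + 1) * (((r : ℝ) + 1) ^ r * m.choose r * (m + 1) +
          ((r : ℝ) + 1) ^ r * m.choose r) + facetFactor r (m + 1) * r := by gcongr
      _ = facetFactor r (m + 1) * ((m : ℝ) + 1 - r) + facetFactor r (m + 1) * r := by
        rw [h3]; ring
      _ = _ := by ring

namespace MDP

variable {S : Type u} {A : Type v} [Fintype S] [DecidableEq S] [DecidableEq A]

/-- The bound for Random-Facet-Blackwell in terms of the hidden dimension `d` and the number `m`
of pairs outside the current policy. If the pair `p` of rank `i` (with respect to the optimum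
without it) is removed and turns out to be improving afterwards, then the hidden dimension drops
by `i`, which gains the factor `(r / (r + 1)) ^ i`. -/
theorem cost_randomFacet_le [Fintype A] {M : MDP S A} {Val : Policy S A → ℝ}
    (hV : M.IsObjective Val) {r : ℕ} (hr : 1 ≤ r) {c : ℝ} (f : ℕ) :
    ∀ (G : Finset (S × A)) (π : Policy S A) (d m : ℕ), pairs π ⊆ G →
      G.card = Fintype.card S + m → Fintype.card S ≤ (enforced Val G π).card + d →
      (G.card : ℝ) + 2 ≤ c →
      (M.randomFacet f G π).cost ≤
        ENNReal.ofReal (c * facetFactor r m * (((r : ℝ) + 1) / r) ^ d) := by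
  have hr0 : (0 : ℝ) < r := by exact_mod_cast hr
  have hlam : 1 ≤ ((r : ℝ) + 1) / r := by rw [one_le_div hr0]; linarith
  induction f with
  | zero =>
    intro G π d m _ _ _ _
    rw [randomFacet, RandM.cost_abort]
    exact zero_le
  | succ f ih =>
    intro G π d m hπ hGm hd hc
    have hc0 : 0 ≤ c := le_trans (by positivity) hc
    have hlamd : 1 ≤ (((r : ℝ) + 1) / r) ^ d := one_le_pow₀ hlam
    have hcast : ((1 + G.card : ℕ) : ℝ≥0∞) = ENNReal.ofReal (1 + G.card) := by
      rw [← ENNReal.ofReal_natCast]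
      push_cast
      rfl
    rw [randomFacet_succ]
    refine (RandM.cost_tick_bind_le _ _).trans ?_
    rw [hcast]
    split_ifs with hopt
    · rw [RandM.cost_pure, add_zero]
      refine ENNReal.ofReal_le_ofReal ?_
      have h1 : 1 ≤ facetFactor r m * (((r : ℝ) + 1) / r) ^ d :=
        one_le_mul_of_one_le_of_one_le (one_le_facetFactor r m) hlamd
      rw [mul_assoc]
      nlinarith
    set H := G \ pairs π with hH
    have hHne : H.Nonempty := hV.sdiff_pairs_nonempty hopt
    have hHcard : H.card = m := by
      rw [hH, Finset.card_sdiff_of_subset hπ, card_pairs, hGm]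
      omega
    obtain ⟨m, rfl⟩ : ∃ m', m = m' + 1 :=
      Nat.exists_eq_succ_of_ne_zero (by rw [← hHcard]; exact hHne.card_pos.ne')
    have hopt' : ∀ q : S × A, ∃ w : ℝ, q ∈ H →
        (∃ σ, pairs σ ⊆ G.erase q ∧ Val σ = w) ∧ ∀ τ, pairs τ ⊆ G.erase q → Val τ ≤ w := by
      intro q
      by_cases hq : q ∈ H
      · obtain ⟨σ, hσ, hmax⟩ := exists_max_objective Val (pairs_subset_erase hπ hq)
        exact ⟨Val σ, fun _ => ⟨⟨σ, hσ, rfl⟩, hmax⟩⟩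
      · exact ⟨0, fun h => absurd h hq⟩
    -- `W q` is the optimum over the policies inside `G` that avoid `q`.
    choose W hW using hopt'
    set rank : S × A → ℕ := fun p => (H.filter fun q => W q ≤ W p).card with hrank
    set x : ℝ := (r : ℝ) / (r + 1) with hx
    have hx0 : 0 ≤ x := by positivity
    have hx1 : x ≤ 1 := by rw [hx, div_le_one (by positivity)]; linarith
    set L : ℝ := (((r : ℝ) + 1) / r) ^ d with hL
    have hKm := one_le_facetFactor r m
    have hKm' := one_le_facetFactor r (m + 1)
    have hfirst : ∀ p ∈ H, (M.randomFacet f (G.erase p) π).cost ≤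
        ENNReal.ofReal (c * facetFactor r m * L) := by
      intro p hp
      have hpG : p ∈ G := (Finset.mem_sdiff.1 hp).1
      refine ih (G.erase p) π d m (pairs_subset_erase hπ hp) ?_ ?_ ?_
      · rw [Finset.card_erase_of_mem hpG]
        omega
      · refine hd.trans (Nat.add_le_add_right (Finset.card_le_card ?_) d)
        exact enforced_mono (Finset.erase_subset _ _) (pairs_subset_erase hπ hp) le_rfl
      · refine le_trans ?_ hc
        gcongr
        exact Finset.erase_subset _ _
    have hsecond : ∀ p ∈ H, ∀ π' c', (M.randomFacet f (G.erase p) π).law (some π', c') ≠ 0 →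
        M.Improving π' p → (M.randomFacet f G (switch p π')).cost ≤
          ENNReal.ofReal (c * facetFactor r (m + 1) * L * x ^ rank p) := by
      intro p hp π' c' hlaw himp
      have hpG : p ∈ G := (Finset.mem_sdiff.1 hp).1
      obtain ⟨hsub, hni⟩ :=
        (ensures_randomFacet hV f _ _ (pairs_subset_erase hπ hp) _ _ hlaw).2 π' rfl
      have hsub' : pairs (switch p π') ⊆ G :=
        pairs_switch_subset hpG (hsub.trans (Finset.erase_subset _ _))
      have hlt : W p < Val (switch p π') := by
        obtain ⟨σ, hσ, hσW⟩ := (hW p hp).1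
        rw [← hσW]
        exact (hV.le_of_not_improving _ π' σ hni hσ).trans_lt (hV.lt_switch π' p himp)
      have hrk := card_enforced_add_rank_le hπ hsub' (fun q hq => (hW q hq).2) hp hlt
      rw [← hH] at hrk
      have hrk2 : (enforced Val G (switch p π')).card ≤ Fintype.card S := by
        rw [← card_pairs (switch p π')]
        exact Finset.card_le_card (enforced_subset _ _ _)
      have hrd : rank p ≤ d := by
        simp only [hrank]
        omega
      refine (ih G (switch p π') (d - rank p) (m + 1) hsub' hGm ?_ hc).trans_eq ?_
      · simp only [hrank] at hrd ⊢
        omega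
      · have : L * x ^ rank p = (((r : ℝ) + 1) / r) ^ (d - rank p) := by
          obtain ⟨e, he⟩ := Nat.exists_eq_add_of_le hrd
          have hx' : x = (((r : ℝ) + 1) / r)⁻¹ := by rw [hx, inv_div]
          rw [hL, he, Nat.add_sub_cancel_left, pow_add, hx', inv_pow]
          field_simp
        rw [mul_assoc (c * _), this]
    have hbranch : ∀ p ∈ H, (M.randomFacet f (G.erase p) π >>= fun π' =>
        RandM.tick 1 >>= fun _ =>
          @ite _ (M.Improving π' p) (Classical.propDecidable _)
            (M.randomFacet f G (switch p π')) (pure π')).cost ≤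
        ENNReal.ofReal (c * facetFactor r m * L +
          (1 + c * facetFactor r (m + 1) * L * x ^ rank p)) := by
      intro p hp
      refine (RandM.cost_bind_le _ _
        (ENNReal.ofReal (1 + c * facetFactor r (m + 1) * L * x ^ rank p)) ?_).trans ?_
      · intro π' c' hlaw
        refine (RandM.cost_tick_bind_le _ _).trans ?_
        rw [ENNReal.ofReal_add zero_le_one (by positivity)]
        refine add_le_add (by simp) ?_
        split_ifs with himp
        · exact hsecond p hp π' c' hlaw himp
        · rw [RandM.cost_pure]
          exact zero_le
      · rw [ENNReal.ofReal_add (p := c * facetFactor r m * L) (by positivity) (by positivity)]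
        exact add_le_add (hfirst p hp) le_rfl
    rw [RandM.cost_uniformFrom_bind _ hHne]
    have hsum_le := Finset.sum_le_sum hbranch
    refine (add_le_add le_rfl (mul_le_mul_right hsum_le _)).trans ?_
    have hnn : ∀ p ∈ H, 0 ≤ c * facetFactor r m * L +
        (1 + c * facetFactor r (m + 1) * L * x ^ rank p) := fun p _ => by positivity
    rw [← ENNReal.ofReal_sum_of_nonneg hnn, ← ENNReal.ofReal_natCast,
      ← ENNReal.ofReal_inv_of_pos (by exact_mod_cast hHne.card_pos),
      ← ENNReal.ofReal_mul (by positivity), ← ENNReal.ofReal_add (by positivity)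
        (mul_nonneg (by positivity) (Finset.sum_nonneg hnn))]
    refine ENNReal.ofReal_le_ofReal ?_
    have hsum := sum_pow_rank_le H W hx0 hx1
    have hfac := facetFactor_succ hr m
    rw [← hx] at hfac
    rw [hHcard] at hsum ⊢
    simp only [Finset.sum_add_distrib, ← Finset.mul_sum, Finset.sum_const, hHcard, nsmul_eq_mul,
      Nat.cast_add, Nat.cast_one]
    set sx := ∑ p ∈ H, x ^ rank p with hsx
    have hm0 : (0 : ℝ) < (m : ℝ) + 1 := by positivity
    have h5 : (m + 1) * (facetFactor r m + 1) + facetFactor r (m + 1) * sx ≤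
        (m + 1) * facetFactor r (m + 1) := by
      refine le_trans ?_ hfac
      gcongr
    have h6 : c * L * ((m + 1) * (facetFactor r m + 1) + facetFactor r (m + 1) * sx) ≤
        c * L * ((m + 1) * facetFactor r (m + 1)) := by gcongr
    have h7 : (1 + (G.card : ℝ)) + 1 ≤ c * L := by nlinarith
    have h8 : (1 + (G.card : ℝ)) + ((m : ℝ) + 1)⁻¹ * (c * facetFactor r m * ((m + 1) * L) +
        ((m + 1) * 1 + c * facetFactor r (m + 1) * L * sx)) =
        ((m + 1) * ((1 + (G.card : ℝ)) + 1) + c * L * ((m + 1) * facetFactor r m +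
          facetFactor r (m + 1) * sx)) / (m + 1) := by
      field_simp
      ring
    rw [h8, div_le_iff₀ hm0]
    nlinarith

end MDP

/-! ### The weighted multiset of pairs -/

namespace MDP

section Copies

variable {S : Type u} {A : Type v} [Fintype S] [Fintype A]

theorem card_copies (w : S × A → ℕ) : Fintype.card (Copies w) = ∑ p, 2 ^ w p := by
  simp [Copies, Fintype.card_sigma]

open Classical in
theorem card_filter_copies (w : S × A → ℕ) (P : S × A → Prop) :
    (Finset.univ.filter fun h : Copies w => P h.1).card =
      ∑ p ∈ Finset.univ.filter P, 2 ^ w p := by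
  have : (Finset.univ.filter fun h : Copies w => P h.1) =
      (Finset.univ.filter P).sigma fun p => (Finset.univ : Finset (Fin (2 ^ w p))) := by
    ext h
    simp
  rw [this, Finset.card_sigma]
  simp

theorem card_mul_card_le_card_copies (w : S × A → ℕ) :
    Fintype.card S * Fintype.card A ≤ Fintype.card (Copies w) := by
  rw [card_copies, ← Fintype.card_prod, ← Finset.card_univ, Finset.card_eq_sum_ones]
  exact Finset.sum_le_sum fun p _ => Nat.one_le_two_pow

theorem powersetCard_copies_nonempty (w : S × A → ℕ)
    (hnk : 6 * Fintype.card S ^ 2 ≤ Fintype.card S * Fintype.card A) :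
    ((Finset.univ : Finset (Copies w)).powersetCard (6 * Fintype.card S ^ 2)).Nonempty := by
  rw [Finset.powersetCard_nonempty, Finset.card_univ]
  exact hnk.trans (card_mul_card_le_card_copies w)

end Copies

/-! ### The sampling lemma for Clarkson's method -/

variable {S : Type u} {A : Type v} [Fintype S] [DecidableEq S] [DecidableEq A]

/-- The pairs available in a sampled problem: the sampled ones and those of `π₀`. -/
def sampledPairs (π₀ : Policy S A) {ι : Type*} (pr : ι → S × A) (Q : Finset ι) :
    Finset (S × A) := Q.image pr ∪ pairs π₀

open Classical in
/-- Counted with multiplicity, the pairs that are improving after solving a random sample of size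
`r` are few: adding such a pair to the sample makes it one of the at most `|S|` pairs of the
optimal policy of the enlarged sample, and it must be the only copy there. -/
theorem sum_card_improving_le {M : MDP S A} {Val : Policy S A → ℝ} (hV : M.IsObjective Val)
    {π₀ : Policy S A} {ι : Type*} [Fintype ι] (pr : ι → S × A) (r : ℕ)
    {opt : Finset ι → Policy S A} (hsub : ∀ Q, pairs (opt Q) ⊆ sampledPairs π₀ pr Q)
    (hopt : ∀ Q, ∀ p ∈ sampledPairs π₀ pr Q, ¬ M.Improving (opt Q) p) :
    ∑ Q ∈ (Finset.univ : Finset ι).powersetCard r,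
        (Finset.univ.filter fun h => M.Improving (opt Q) (pr h)).card ≤
      (Fintype.card ι).choose (r + 1) * Fintype.card S := by
  set V : Finset ι → Finset ι := fun Q => Finset.univ.filter fun h => M.Improving (opt Q) (pr h)
    with hVdef
  set E : Finset ι → Finset ι := fun Q => Q.filter fun h => h ∈ V (Q.erase h) with hE
  have hmemV : ∀ {Q h}, h ∈ V Q → M.Improving (opt Q) (pr h) := fun hh =>
    (Finset.mem_filter.1 hh).2
  have hpr : ∀ {Q : Finset ι} {h}, h ∈ Q → pr h ∈ sampledPairs π₀ pr Q := fun hh =>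
    Finset.mem_union_left _ (Finset.mem_image_of_mem pr hh)
  have hnotmem : ∀ {Q h}, h ∈ V Q → h ∉ Q := fun hh hQ => hopt _ _ (hpr hQ) (hmemV hh)
  have hEcard : ∀ Q, (E Q).card ≤ Fintype.card S := by
    intro Q
    rw [← card_pairs (opt Q)]
    refine Finset.card_le_card_of_injOn pr ?_ ?_
    · intro h hh
      obtain ⟨hQ, hv⟩ := Finset.mem_filter.1 (Finset.mem_coe.1 hh)
      have himp := hmemV hv
      by_contra hne
      have h1 : pairs (opt Q) ⊆ sampledPairs π₀ pr (Q.erase h) := by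
        intro q hq
        rcases Finset.mem_union.1 (hsub Q hq) with h2 | h2
        · obtain ⟨g, hg, rfl⟩ := Finset.mem_image.1 h2
          exact hpr (Finset.mem_erase.2 ⟨fun e => hne (Finset.mem_coe.2 (e ▸ hq)), hg⟩)
        · exact Finset.mem_union_right _ h2
      have h2 : pairs (switch (pr h) (opt (Q.erase h))) ⊆ sampledPairs π₀ pr Q := by
        refine pairs_switch_subset (hpr hQ) ((hsub _).trans ?_)
        exact Finset.union_subset_union
          (Finset.image_subset_image (Finset.erase_subset _ _)) le_rfl
      have h3 := hV.le_of_not_improving _ _ _ (hopt (Q.erase h)) h1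
      have h4 := hV.le_of_not_improving _ _ _ (hopt Q) h2
      have h5 := hV.lt_switch _ _ himp
      linarith
    · intro h hh g hg hhg
      obtain ⟨hQ, hv⟩ := Finset.mem_filter.1 (Finset.mem_coe.1 hh)
      obtain ⟨gQ, -⟩ := Finset.mem_filter.1 (Finset.mem_coe.1 hg)
      by_contra hne
      refine hopt (Q.erase h) (pr h) ?_ (hmemV hv)
      rw [hhg]
      exact hpr (Finset.mem_erase.2 ⟨fun e => hne e.symm, gQ⟩)
  calc ∑ Q ∈ (Finset.univ : Finset ι).powersetCard r, (V Q).card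
      = (((Finset.univ : Finset ι).powersetCard r).sigma V).card := (Finset.card_sigma _ _).symm
    _ ≤ (((Finset.univ : Finset ι).powersetCard (r + 1)).sigma E).card := by
        refine Finset.card_le_card_of_injOn (fun x => ⟨insert x.2 x.1, x.2⟩) ?_ ?_
        · rintro ⟨Q, h⟩ hx
          obtain ⟨hQ, hh⟩ := Finset.mem_sigma.1 (Finset.mem_coe.1 hx)
          have hn := hnotmem hh
          refine Finset.mem_coe.2 (Finset.mem_sigma.2 ⟨?_, ?_⟩)
          · rw [Finset.mem_powersetCard_univ] at hQ ⊢
            rw [Finset.card_insert_of_notMem hn, hQ]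
          · refine Finset.mem_filter.2 ⟨Finset.mem_insert_self _ _, ?_⟩
            rwa [Finset.erase_insert hn]
        · rintro ⟨Q, h⟩ hx ⟨Q', h'⟩ hx' heq
          obtain ⟨-, hh⟩ := Finset.mem_sigma.1 (Finset.mem_coe.1 hx)
          obtain ⟨-, hh'⟩ := Finset.mem_sigma.1 (Finset.mem_coe.1 hx')
          simp only [Sigma.mk.injEq, heq_eq_eq] at heq
          obtain ⟨h1, rfl⟩ := heq
          have : Q = Q' := by
            rw [← Finset.erase_insert (a := h) (s := Q) (hnotmem hh), h1,
              Finset.erase_insert (a := h) (s := Q') (hnotmem hh')]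
          rw [this]
    _ = ∑ Q ∈ (Finset.univ : Finset ι).powersetCard (r + 1), (E Q).card := Finset.card_sigma _ _
    _ ≤ ((Finset.univ : Finset ι).powersetCard (r + 1)).card * Fintype.card S := by
        rw [← smul_eq_mul]
        exact Finset.sum_le_card_nsmul _ _ _ fun Q _ => hEcard Q
    _ = _ := by rw [Finset.card_powersetCard, Finset.card_univ]

open Classical in
/-- With a sample of size `6 |S|²`, the improving pairs have more than the fraction `1 / (3 |S|)`
of the total weight for at most half of the samples (Markov's inequality). -/
theorem two_mul_card_heavy_le [Nonempty S] {M : MDP S A} {Val : Policy S A → ℝ}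
    (hV : M.IsObjective Val) {π₀ : Policy S A} {ι : Type*} [Fintype ι] (pr : ι → S × A)
    {opt : Finset ι → Policy S A} (hsub : ∀ Q, pairs (opt Q) ⊆ sampledPairs π₀ pr Q)
    (hopt : ∀ Q, ∀ p ∈ sampledPairs π₀ pr Q, ¬ M.Improving (opt Q) p) :
    2 * (((Finset.univ : Finset ι).powersetCard (6 * Fintype.card S ^ 2)).filter fun Q =>
        Fintype.card ι < 3 * Fintype.card S *
          (Finset.univ.filter fun h => M.Improving (opt Q) (pr h)).card).card ≤
      ((Finset.univ : Finset ι).powersetCard (6 * Fintype.card S ^ 2)).card := by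
  set n := Fintype.card S
  have hn : 0 < n := Fintype.card_pos
  set N := Fintype.card ι
  set r := 6 * n ^ 2 with hr
  set P := (Finset.univ : Finset ι).powersetCard r
  set v : Finset ι → ℕ := fun Q => (Finset.univ.filter fun h => M.Improving (opt Q) (pr h)).card
  set bad := P.filter fun Q => N < 3 * n * v Q
  have hsum : ∑ Q ∈ P, v Q ≤ N.choose (r + 1) * n := sum_card_improving_le hV pr r hsub hopt
  have hP : P.card = N.choose r := by rw [Finset.card_powersetCard, Finset.card_univ]
  have h1 : bad.card * (N + 1) ≤ 3 * n * ∑ Q ∈ P, v Q := by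
    calc bad.card * (N + 1) ≤ ∑ Q ∈ bad, 3 * n * v Q := by
          rw [← smul_eq_mul]
          exact Finset.card_nsmul_le_sum _ _ _ fun Q hQ => (Finset.mem_filter.1 hQ).2
      _ ≤ ∑ Q ∈ P, 3 * n * v Q := Finset.sum_le_sum_of_subset (Finset.filter_subset _ _)
      _ = _ := (Finset.mul_sum _ _ _).symm
  have h2 : N.choose (r + 1) * (r + 1) ≤ N.choose r * N := by
    rw [Nat.choose_succ_right_eq]
    exact Nat.mul_le_mul_left _ (Nat.sub_le _ _)
  rw [hP]
  refine Nat.le_of_mul_le_mul_right (c := N + 1) ?_ (Nat.succ_pos N)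
  calc 2 * bad.card * (N + 1) = 2 * (bad.card * (N + 1)) := by ring
    _ ≤ 2 * (3 * n * (N.choose (r + 1) * n)) := by
        refine Nat.mul_le_mul_left _ (h1.trans (Nat.mul_le_mul_left _ hsum))
    _ = N.choose (r + 1) * r := by rw [hr]; ring
    _ ≤ N.choose (r + 1) * (r + 1) := Nat.mul_le_mul_left _ (Nat.le_succ r)
    _ ≤ N.choose r * N := h2
    _ ≤ N.choose r * (N + 1) := Nat.mul_le_mul_left _ (Nat.le_succ N)

/-! ### Clarkson's reweighting rounds -/

variable [Fintype A]

open Classical in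
theorem clarksonLoop_succ (M : MDP S A) (π₀ : Policy S A) (f j : ℕ) (w : S × A → ℕ) :
    M.clarksonLoop π₀ f (j + 1) w =
      (RandM.tick (1 + 6 * Fintype.card S ^ 2 + Fintype.card S * Fintype.card A) >>= fun _ =>
        RandM.uniformFrom
            ((Finset.univ : Finset (Copies w)).powersetCard (6 * Fintype.card S ^ 2)) >>= fun Q =>
          M.randomFacet f (sampledPairs π₀ Sigma.fst Q) π₀ >>= fun π =>
            if (Finset.univ.filter fun p => M.Improving π p) = ∅ then pure π
            else if 3 * Fintype.card S * ∑ p ∈ Finset.univ.filter (fun p => M.Improving π p),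
                2 ^ w p ≤ ∑ p, 2 ^ w p then
              M.clarksonLoop π₀ f j fun p =>
                if p ∈ Finset.univ.filter (fun p => M.Improving π p) then w p + 1 else w p
            else M.clarksonLoop π₀ f j w) := by
  rw [clarksonLoop]
  rfl

open Classical in
/-- The method returns policies without improving pairs, and is cut off after `j` rounds, or at the
recursion depth `f ≥ j` within a round, only after `j` steps. -/
theorem ensures_clarksonLoop {M : MDP S A} {Val : Policy S A → ℝ} (hV : M.IsObjective Val)
    (hnk : 6 * Fintype.card S ^ 2 ≤ Fintype.card S * Fintype.card A) (π₀ : Policy S A) (f j : ℕ)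
    (hj : j ≤ f) : ∀ w : S × A → ℕ,
      RandM.Ensures (M.clarksonLoop π₀ f j w) fun x c => (x = none → j ≤ c) ∧
        ∀ σ, x = some σ → ∀ p, ¬ M.Improving σ p := by
  induction j with
  | zero =>
    intro w
    rw [clarksonLoop]
    exact RandM.ensures_abort ⟨fun _ => le_rfl, by simp⟩
  | succ j ih =>
    intro w
    have ih := ih (Nat.le_of_succ_le hj)
    rw [clarksonLoop_succ]
    refine RandM.ensures_tick_bind _ _ ?_
    refine RandM.ensures_uniformFrom_bind _ (powersetCard_copies_nonempty w hnk) _ fun Q hQ => ?_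
    have hRF := ensures_randomFacet hV f (sampledPairs π₀ Sigma.fst Q) π₀
      Finset.subset_union_right
    refine RandM.ensures_bind _ _ ?_ ?_
    · intro c hc
      refine ⟨fun _ => ?_, by simp⟩
      have := (hRF _ _ hc).1 rfl
      omega
    · intro π c _
      have hloop : ∀ w', RandM.Ensures (M.clarksonLoop π₀ f j w') fun x c' =>
          (x = none → j + 1 ≤
            1 + 6 * Fintype.card S ^ 2 + Fintype.card S * Fintype.card A + (c + c')) ∧
          ∀ σ, x = some σ → ∀ p, ¬ M.Improving σ p := by
        intro w' x c' hx
        have := ih w' x c' hx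
        exact ⟨fun hn => by have := this.1 hn; omega, this.2⟩
      split_ifs with hempty hlight
      · refine RandM.ensures_pure _ ⟨by simp, fun σ hσ p himp => ?_⟩
        cases hσ
        exact Finset.eq_empty_iff_forall_notMem.1 hempty p
          (Finset.mem_filter.2 ⟨Finset.mem_univ _, himp⟩)
      · exact hloop _
      · exact hloop _

/-- The state of the weights after `t` doublings, for an optimal policy `πs`: each doubling has
increased the weight of a pair of `πs`, and the total weight by a factor of at most
`1 + 1 / (3 |S|)`. -/
structure WeightsAfter (πs : Policy S A) (t : ℕ) (w : S × A → ℕ) : Prop where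
  le_sum : t ≤ ∑ p ∈ pairs πs, w p
  total_le : ((∑ p, 2 ^ w p : ℕ) : ℝ) ≤
    Fintype.card S * Fintype.card A * (1 + 1 / (3 * Fintype.card S)) ^ t

/-- The weight of some pair of `πs` is at least `2 ^ (t / |S|)` after `t` doublings, which
outgrows the total weight; so there are few doublings. -/
theorem WeightsAfter.le [Nonempty S] [Nonempty A] {πs : Policy S A} {t : ℕ} {w : S × A → ℕ}
    (h : WeightsAfter πs t w) :
    t ≤ 3 * (Fintype.card S * Fintype.card A * Fintype.card S) := by
  set n := Fintype.card S with hn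
  set k := Fintype.card A with hk
  have hn0 : 0 < n := Fintype.card_pos
  have hn0' : (0 : ℝ) < n := by exact_mod_cast hn0
  obtain ⟨p, hp, hmax⟩ := Finset.exists_max_image (pairs πs) w
    (Finset.card_pos.1 (by rw [card_pairs]; exact hn0))
  have htw : t ≤ n * w p := by
    refine h.le_sum.trans ?_
    rw [hn, ← card_pairs πs, ← smul_eq_mul]
    exact Finset.sum_le_card_nsmul _ _ _ hmax
  have hwp : 2 ^ w p ≤ ∑ p, 2 ^ w p :=
    Finset.single_le_sum (f := fun p => 2 ^ w p) (fun _ _ => Nat.zero_le _) (Finset.mem_univ p)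
  have hgrow : (1 + 1 / (3 * (n : ℝ))) ^ n ≤ 3 / 2 := by
    have h1 : (1 + 1 / (3 * (n : ℝ))) ^ n ≤ Real.exp (1 / 3) := by
      calc (1 + 1 / (3 * (n : ℝ))) ^ n ≤ (Real.exp (1 / (3 * n))) ^ n := by
            gcongr
            linarith [Real.add_one_le_exp (1 / (3 * (n : ℝ)))]
        _ = Real.exp (1 / 3) := by
            rw [← Real.exp_nat_mul]
            congr 1
            field_simp
    have h2 : Real.exp (1 / 3) ^ 3 ≤ (3 / 2) ^ 3 := by
      rw [← Real.exp_nat_mul]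
      have := Real.exp_one_lt_d9
      norm_num at this ⊢
      linarith
    exact h1.trans (le_of_pow_le_pow_left₀ (by norm_num) (by norm_num) h2)
  have hmain : (2 : ℝ) ^ t ≤ (n * k : ℝ) ^ n * (3 / 2) ^ t := by
    calc (2 : ℝ) ^ t ≤ 2 ^ (n * w p) := pow_le_pow_right₀ (by norm_num) htw
      _ = (2 ^ w p) ^ n := by rw [mul_comm, pow_mul]
      _ ≤ ((n * k : ℝ) * (1 + 1 / (3 * n)) ^ t) ^ n := by
          refine pow_le_pow_left₀ (by positivity) (le_trans ?_ h.total_le) n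
          exact_mod_cast hwp
      _ = (n * k : ℝ) ^ n * ((1 + 1 / (3 * (n : ℝ))) ^ n) ^ t := by
          rw [mul_pow, ← pow_mul, ← pow_mul, mul_comm t n]
      _ ≤ _ := by gcongr
  have h43 : (4 / 3 : ℝ) ^ t ≤ (n * k : ℝ) ^ n := by
    have h1 : (2 : ℝ) ^ t = (4 / 3) ^ t * (3 / 2) ^ t := by
      rw [← mul_pow]
      norm_num
    rw [h1] at hmain
    exact le_of_mul_le_mul_right hmain (by positivity)
  have hnk : (n * k : ℝ) ≤ ((4 / 3 : ℝ) ^ 3) ^ (n * k) := by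
    calc (n * k : ℝ) ≤ 2 ^ (n * k) := by exact_mod_cast (Nat.lt_two_pow_self (n := n * k)).le
      _ ≤ _ := pow_le_pow_left₀ (by norm_num) (by norm_num) _
  have hfin : (4 / 3 : ℝ) ^ t ≤ (4 / 3 : ℝ) ^ (3 * (n * k * n)) := by
    calc (4 / 3 : ℝ) ^ t ≤ (n * k : ℝ) ^ n := h43
      _ ≤ (((4 / 3 : ℝ) ^ 3) ^ (n * k)) ^ n := pow_le_pow_left₀ (by positivity) hnk n
      _ = _ := by rw [← pow_mul, ← pow_mul, ← mul_assoc 3]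
  exact (pow_le_pow_iff_right₀ (by norm_num)).1 hfin

open Classical in
/-- A doubling of the improving pairs of `π`. If these avoided the optimal policy `πs`, then `π`
would be optimal without admitting an improvement. -/
theorem WeightsAfter.succ [Nonempty S] {M : MDP S A} {Val : Policy S A → ℝ}
    (hV : M.IsObjective Val)
    {πs π : Policy S A} (hs : ∀ p, ¬ M.Improving πs p) {t : ℕ} {w : S × A → ℕ}
    (h : WeightsAfter πs t w)
    (hne : (Finset.univ.filter fun p => M.Improving π p) ≠ ∅)
    (hlight : 3 * Fintype.card S * ∑ p ∈ Finset.univ.filter (fun p => M.Improving π p), 2 ^ w p ≤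
      ∑ p, 2 ^ w p) :
    WeightsAfter πs (t + 1) fun p =>
      if p ∈ Finset.univ.filter (fun p => M.Improving π p) then w p + 1 else w p := by
  set V := Finset.univ.filter fun p => M.Improving π p with hVdef
  have hmem : ∀ p, p ∈ V ↔ M.Improving π p := fun p => by simp [hVdef]
  constructor
  · obtain ⟨p, hp, hpV⟩ : ∃ p ∈ pairs πs, p ∈ V := by
      by_contra! hno
      obtain ⟨q, hq⟩ := Finset.nonempty_iff_ne_empty.2 hne
      have h1 := hV.le_of_not_improving (pairs πs) π πs
        (fun p hp himp => hno p hp ((hmem p).2 himp)) le_rfl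
      have h2 := hV.lt_switch π q ((hmem q).1 hq)
      have h3 := hV.le_of_not_improving Finset.univ πs (switch q π) (fun p _ => hs p)
        (Finset.subset_univ _)
      linarith
    refine Nat.succ_le_of_lt (h.le_sum.trans_lt (Finset.sum_lt_sum (fun q _ => ?_) ⟨p, hp, ?_⟩))
    · split_ifs <;> omega
    · rw [if_pos hpV]
      omega
  · have hsum : ∑ p, 2 ^ (if p ∈ V then w p + 1 else w p) =
        ∑ p, 2 ^ w p + ∑ p ∈ V, 2 ^ w p := by
      rw [← Finset.sum_filter_add_sum_filter_not Finset.univ (· ∈ V),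
        ← Finset.sum_filter_add_sum_filter_not Finset.univ (· ∈ V) (fun p => 2 ^ w p)]
      have e1 : ∑ p ∈ Finset.univ.filter (· ∈ V), 2 ^ (if p ∈ V then w p + 1 else w p) =
          ∑ p ∈ V, 2 ^ w p + ∑ p ∈ V, 2 ^ w p := by
        rw [Finset.filter_univ_mem, ← Finset.sum_add_distrib]
        refine Finset.sum_congr rfl fun p hp => ?_
        rw [if_pos hp]
        ring
      have e2 : ∑ p ∈ Finset.univ.filter (· ∉ V), 2 ^ (if p ∈ V then w p + 1 else w p) =
          ∑ p ∈ Finset.univ.filter (· ∉ V), 2 ^ w p :=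
        Finset.sum_congr rfl fun p hp => by rw [if_neg (Finset.mem_filter.1 hp).2]
      rw [e1, e2, Finset.filter_univ_mem]
      ring
    rw [hsum, Nat.cast_add, pow_succ, ← mul_assoc]
    have hn0 : (0 : ℝ) < Fintype.card S := by exact_mod_cast (Fintype.card_pos (α := S))
    have h1 : ((∑ p ∈ V, 2 ^ w p : ℕ) : ℝ) ≤
        (∑ p, 2 ^ w p : ℕ) * (1 / (3 * Fintype.card S)) := by
      rw [mul_one_div, le_div_iff₀ (by positivity), mul_comm]
      exact_mod_cast hlight
    calc _ ≤ ((∑ p, 2 ^ w p : ℕ) : ℝ) * (1 + 1 / (3 * Fintype.card S)) := by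
          rw [mul_add, mul_one]
          exact add_le_add le_rfl h1
      _ ≤ _ := by
          gcongr
          exact h.total_le

/-- The expected number of rounds is at most twice the number of remaining doublings, plus two. -/
theorem cost_clarksonLoop_le [Nonempty S] [Nonempty A] {M : MDP S A} {Val : Policy S A → ℝ}
    (hV : M.IsObjective Val)
    (hnk : 6 * Fintype.card S ^ 2 ≤ Fintype.card S * Fintype.card A) (π₀ : Policy S A) (f : ℕ)
    {πs : Policy S A} (hs : ∀ p, ¬ M.Improving πs p) {b : ℝ≥0∞}
    (hb : ∀ G : Finset (S × A), pairs π₀ ⊆ G →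
      G.card ≤ 6 * Fintype.card S ^ 2 + Fintype.card S → (M.randomFacet f G π₀).cost ≤ b)
    (j : ℕ) : ∀ (t : ℕ) (w : S × A → ℕ), WeightsAfter πs t w →
      (M.clarksonLoop π₀ f j w).cost ≤
        2 * ((1 + 6 * Fintype.card S ^ 2 + Fintype.card S * Fintype.card A : ℕ) + b) *
          (3 * (Fintype.card S * Fintype.card A * Fintype.card S) + 1 - t : ℕ) := by
  classical
  set T := 3 * (Fintype.card S * Fintype.card A * Fintype.card S) with hT
  set c₀ : ℕ := 1 + 6 * Fintype.card S ^ 2 + Fintype.card S * Fintype.card A with hc₀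
  set B : ℝ≥0∞ := c₀ + b with hB
  induction j with
  | zero =>
    intro t w _
    rw [clarksonLoop, RandM.cost_abort]
    exact zero_le
  | succ j ih =>
    intro t w hw
    have htT : t ≤ T := hw.le
    set X : ℝ≥0∞ := 2 * B * (T + 1 - (t + 1) : ℕ) with hX
    have hXt : 2 * B * (T + 1 - t : ℕ) = X + 2 * B := by
      have : T + 1 - t = (T + 1 - (t + 1)) + 1 := by omega
      rw [hX, this]
      push_cast
      ring
    set P := (Finset.univ : Finset (Copies w)).powersetCard (6 * Fintype.card S ^ 2) with hP
    have hPne : P.Nonempty := powersetCard_copies_nonempty w hnk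
    have hopt : ∀ Q : Finset (Copies w), ∃ σ : Policy S A,
        pairs σ ⊆ sampledPairs π₀ Sigma.fst Q ∧
          ∀ p ∈ sampledPairs π₀ Sigma.fst Q, ¬ M.Improving σ p := fun Q =>
      hV.exists_not_improving (π := π₀) Finset.subset_union_right
    -- Whether a sample is heavy does not depend on the randomness of the recursive solution,
    -- because all solutions of the sampled problem have the same improving pairs.
    choose opt hsub hni using hopt
    set heavy : Finset (Copies w) → Prop := fun Q => Fintype.card (Copies w) <
      3 * Fintype.card S * (Finset.univ.filter fun h : Copies w => M.Improving (opt Q) h.1).card with hheavy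
    have hhalf : 2 * (P.filter heavy).card ≤ P.card :=
      by convert two_mul_card_heavy_le hV (Sigma.fst : Copies w → S × A) hsub hni
    rw [clarksonLoop_succ]
    refine (RandM.cost_tick_bind_le _ _).trans ?_
    rw [RandM.cost_uniformFrom_bind _ hPne]
    have hround : ∀ Q ∈ P, (M.randomFacet f (sampledPairs π₀ Sigma.fst Q) π₀ >>= fun π =>
            if (Finset.univ.filter fun p => M.Improving π p) = ∅ then pure π
            else if 3 * Fintype.card S * ∑ p ∈ Finset.univ.filter (fun p => M.Improving π p),
                2 ^ w p ≤ ∑ p, 2 ^ w p then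
              M.clarksonLoop π₀ f j fun p =>
                if p ∈ Finset.univ.filter (fun p => M.Improving π p) then w p + 1 else w p
            else M.clarksonLoop π₀ f j w).cost ≤
        b + (X + if heavy Q then 2 * B else 0) := by
      intro Q hQ
      refine (RandM.cost_bind_le _ _ (X + if heavy Q then 2 * B else 0) ?_).trans
        (add_le_add (hb _ Finset.subset_union_right ?_) le_rfl)
      · intro π c hlaw
        obtain ⟨hπsub, hπni⟩ := (ensures_randomFacet hV f _ _
          Finset.subset_union_right _ _ hlaw).2 π rfl
        have hcongr := hV.improving_congr _ π (opt Q) hπsub (hsub Q) hπni (hni Q)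
        have hVeq : (Finset.univ.filter fun p => M.Improving π p) =
            Finset.univ.filter fun p => M.Improving (opt Q) p :=
          Finset.filter_congr fun p _ => hcongr p
        by_cases hempty : (Finset.univ.filter fun p => M.Improving π p) = ∅
        · rw [if_pos hempty, RandM.cost_pure]
          exact zero_le
        rw [if_neg hempty]
        by_cases hlight : 3 * Fintype.card S *
            ∑ p ∈ Finset.univ.filter (fun p => M.Improving π p), 2 ^ w p ≤ ∑ p, 2 ^ w p
        · rw [if_pos hlight]
          exact (ih _ _ (hw.succ hV hs hempty hlight)).trans le_self_add
        · have hh : heavy Q := by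
            simp only [hheavy]
            rw [card_filter_copies w (fun p => M.Improving (opt Q) p), card_copies, ← hVeq]
            exact not_le.1 hlight
          rw [if_neg hlight, if_pos hh, ← hXt]
          exact ih _ _ hw
      · refine (Finset.card_union_le _ _).trans (add_le_add (Finset.card_image_le.trans ?_) ?_)
        · exact (Finset.mem_powersetCard.1 hQ).2.le
        · exact (card_pairs π₀).le
    have hPc0 : (P.card : ℝ≥0∞) ≠ 0 := by exact_mod_cast hPne.card_pos.ne'
    have hsum : ∑ Q ∈ P, (b + (X + if heavy Q then 2 * B else 0)) ≤ P.card * (b + (X + B)) := by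
      have hbad : ((P.filter heavy).card : ℝ≥0∞) * (2 * B) ≤ P.card * B := by
        calc ((P.filter heavy).card : ℝ≥0∞) * (2 * B) = (2 * (P.filter heavy).card : ℕ) * B := by
              push_cast
              ring
          _ ≤ P.card * B := mul_le_mul_left (by exact_mod_cast hhalf) _
      rw [Finset.sum_add_distrib, Finset.sum_add_distrib, ← Finset.sum_filter]
      simp only [Finset.sum_const, nsmul_eq_mul, mul_add]
      exact add_le_add le_rfl (add_le_add le_rfl (by simpa only [mul_add] using hbad))
    calc _ ≤ (c₀ : ℝ≥0∞) + (P.card : ℝ≥0∞)⁻¹ * (P.card * (b + (X + B))) := by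
          refine add_le_add le_rfl ?_
          exact mul_le_mul_right ((Finset.sum_le_sum hround).trans hsum) _
      _ = c₀ + (b + (X + B)) := by
          rw [← mul_assoc, ENNReal.inv_mul_cancel hPc0 (ENNReal.natCast_ne_top _), one_mul]
      _ = X + 2 * B := by rw [hB]; ring
      _ = _ := hXt.symm

end MDP

/-! ### The choice of the parameter and the numerical estimates -/

theorem facetFactor_le (r m : ℕ) :
    facetFactor r m ≤ ((r : ℝ) + 1) ^ r * ((m : ℝ) + 1) ^ (r + 1) := by
  have hm : (1 : ℝ) ≤ m + 1 := by simp
  rw [facetFactor]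
  split_ifs with h
  · gcongr
    · simp
    · exact le_self_pow₀ hm (Nat.succ_ne_zero r)
  · rw [pow_succ' ((m : ℝ) + 1), ← mul_assoc]
    gcongr
    calc ((m.choose r : ℕ) : ℝ) ≤ (m : ℝ) ^ r := by exact_mod_cast Nat.choose_le_pow m r
      _ ≤ _ := by gcongr; simp

/-- The bound for Random-Facet-Blackwell with `n` states on at most `N` pairs. -/
noncomputable def facetBound (n N : ℕ) : ℝ :=
  3 * Real.exp 6 * (N : ℝ) ^ 7 * Real.exp (5 * Real.sqrt (n * (Real.log N + 1)))

/-- The parameter `r` is chosen as `√(n / log N)`, up to rounding, which balances the factors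
`N ^ O(r)` and `(1 + 1 / r) ^ n`. -/
theorem exists_facetFactor_le {n N m : ℕ} (hn : 1 ≤ n) (hnN : n ≤ N) (hm : m ≤ N) :
    ∃ r : ℕ, 1 ≤ r ∧
      ((N : ℝ) + 2) * facetFactor r m * (((r : ℝ) + 1) / r) ^ n ≤ facetBound n N := by
  have hn' : (1 : ℝ) ≤ n := by exact_mod_cast hn
  have hN' : (1 : ℝ) ≤ N := hn'.trans (by exact_mod_cast hnN)
  set L := Real.log N + 1 with hL
  have hL1 : 1 ≤ L := by linarith [Real.log_nonneg hN']
  set s := Real.sqrt (n / L) with hs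
  have hs0 : 0 < s := Real.sqrt_pos.2 (by positivity)
  have hsn : s ≤ n := by
    rw [hs, Real.sqrt_le_left (by positivity)]
    calc (n : ℝ) / L ≤ n := div_le_self (by positivity) hL1
      _ ≤ (n : ℝ) ^ 2 := by nlinarith
  set q := Real.sqrt (n * L) with hq
  have hLs : L * s = q := by
    rw [hs, hq, ← Real.sqrt_sq (by positivity : (0 : ℝ) ≤ L), ← Real.sqrt_mul (by positivity),
      Real.sqrt_sq (by positivity)]
    congr 1
    field_simp
  have hsq : s * q = n := by
    rw [hs, hq, ← Real.sqrt_mul (by positivity), show (n : ℝ) / L * (n * L) = n ^ 2 by field_simp]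
    exact Real.sqrt_sq (by positivity)
  refine ⟨⌈s⌉₊, Nat.one_le_ceil_iff.2 hs0, ?_⟩
  set r := ⌈s⌉₊ with hr
  have hrs : s ≤ r := Nat.le_ceil s
  have hrs1 : (r : ℝ) ≤ s + 1 := (Nat.ceil_lt_add_one hs0.le).le
  have hr0 : (0 : ℝ) < r := hs0.trans_le hrs
  have hrN : (r : ℝ) ≤ N := by
    have : r ≤ n := Nat.ceil_le.2 hsn
    exact_mod_cast this.trans hnN
  have hmN : (m : ℝ) ≤ N := by exact_mod_cast hm
  have hexpL : Real.exp L = Real.exp 1 * N := by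
    rw [hL, Real.exp_add, Real.exp_log (by linarith), mul_comm]
  have hN2 : (N : ℝ) + 2 ≤ Real.exp (2 * L) := by
    have he : Real.exp (2 * L) = (Real.exp 1 * N) ^ 2 := by
      rw [← hexpL, ← Real.exp_nat_mul]
      norm_num
    have he1 := Real.exp_one_gt_d9
    have hE2 : 7 * (N : ℝ) ^ 2 ≤ (Real.exp 1 * N) ^ 2 := by
      rw [mul_pow]
      gcongr
      nlinarith
    rw [he]
    nlinarith
  have hfac : facetFactor r m ≤ Real.exp (4 * q) * (Real.exp 6 * (N : ℝ) ^ 6) := by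
    calc facetFactor r m ≤ ((r : ℝ) + 1) ^ r * ((m : ℝ) + 1) ^ (r + 1) := facetFactor_le r m
      _ ≤ ((N : ℝ) + 2) ^ r * ((N : ℝ) + 2) ^ (r + 1) := by gcongr <;> linarith
      _ = ((N : ℝ) + 2) ^ (2 * r + 1) := by rw [← pow_add]; ring_nf
      _ ≤ Real.exp (2 * L) ^ (2 * r + 1) := by gcongr
      _ = Real.exp ((2 * r + 1) * (2 * L)) := by
          rw [← Real.exp_nat_mul]
          push_cast
          rfl
      _ ≤ Real.exp (4 * q + 6 * L) := by
          refine Real.exp_le_exp.2 ?_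
          rw [← hLs]
          nlinarith
      _ = Real.exp (4 * q) * (Real.exp 6 * (N : ℝ) ^ 6) := by
          have h6 : Real.exp (6 * L) = Real.exp 6 * (N : ℝ) ^ 6 := by
            have h7 : Real.exp (6 * L) = Real.exp L ^ 6 := by
              rw [← Real.exp_nat_mul]
              norm_num
            have h8 : Real.exp 6 = Real.exp 1 ^ 6 := by
              rw [← Real.exp_nat_mul]
              norm_num
            rw [h7, hexpL, mul_pow, h8]
          rw [Real.exp_add, h6]
  have hlam : (((r : ℝ) + 1) / r) ^ n ≤ Real.exp q := by
    calc (((r : ℝ) + 1) / r) ^ n ≤ (Real.exp (1 / r)) ^ n := by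
          gcongr
          calc ((r : ℝ) + 1) / r = 1 / r + 1 := by field_simp; ring
            _ ≤ _ := Real.add_one_le_exp _
      _ = Real.exp (n / r) := by
          rw [← Real.exp_nat_mul]
          congr 1
          field_simp
      _ ≤ _ := by
          refine Real.exp_le_exp.2 ?_
          rw [div_le_iff₀ hr0, ← hsq, mul_comm]
          exact mul_le_mul_of_nonneg_left hrs (Real.sqrt_nonneg _)
  have hf0 : 0 ≤ facetFactor r m := zero_le_one.trans (one_le_facetFactor r m)
  calc ((N : ℝ) + 2) * facetFactor r m * (((r : ℝ) + 1) / r) ^ n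
      ≤ (3 * N) * (Real.exp (4 * q) * (Real.exp 6 * (N : ℝ) ^ 6)) * Real.exp q := by
        gcongr
        linarith
    _ = facetBound n N := by
        rw [facetBound, show 5 * Real.sqrt (n * (Real.log N + 1)) = 4 * q + q by rw [hq]; ring,
          Real.exp_add]
        ring

theorem sqrt_mul_log_add_one_le {n N : ℕ} (hn : 1 ≤ n) (hnN : n ≤ N) :
    Real.sqrt (n * (Real.log N + 1)) ≤ 2 * Real.sqrt (n * Real.log N) + 1 := by
  by_cases h : 2 ≤ N
  · have hlog : Real.log 2 ≤ Real.log N :=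
      Real.log_le_log (by norm_num) (by exact_mod_cast h)
    have h2 := Real.log_two_gt_d9
    have : Real.sqrt (n * (Real.log N + 1)) ≤ 2 * Real.sqrt (n * Real.log N) := by
      rw [show (2 : ℝ) = Real.sqrt (2 ^ 2) by rw [Real.sqrt_sq]; norm_num,
        ← Real.sqrt_mul (by norm_num)]
      refine Real.sqrt_le_sqrt ?_
      have hn0 : (0 : ℝ) ≤ n := Nat.cast_nonneg n
      nlinarith
    linarith
  · obtain rfl : N = 1 := by omega
    obtain rfl : n = 1 := by omega
    simp

theorem facetBound_le_of_le {n N : ℕ} (hn : 1 ≤ n) (hnN : n ≤ N) :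
    facetBound n N ≤
      3 * Real.exp 11 * (N : ℝ) ^ 7 * Real.exp (10 * Real.sqrt (n * Real.log N)) := by
  have h := sqrt_mul_log_add_one_le hn hnN
  calc facetBound n N ≤ 3 * Real.exp 6 * (N : ℝ) ^ 7 *
        Real.exp (5 + 10 * Real.sqrt (n * Real.log N)) := by
        rw [facetBound]
        gcongr
        linarith
    _ = _ := by
        rw [Real.exp_add, show (11 : ℝ) = 6 + 5 by norm_num, Real.exp_add]
        ring

theorem facetBound_seven_sq_le {n : ℕ} (hn : 1 ≤ n) :
    facetBound n (7 * n ^ 2) ≤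
      3 * Real.exp 16 * 7 ^ 7 * (n : ℝ) ^ 14 * Real.exp (15 * Real.sqrt (n * Real.log n)) := by
  have hn' : (1 : ℝ) ≤ n := by exact_mod_cast hn
  have hlog7 : Real.log 7 ≤ 2 := by
    rw [Real.log_le_iff_le_exp (by norm_num), show (2 : ℝ) = 1 + 1 by norm_num, Real.exp_add]
    nlinarith [Real.exp_one_gt_d9]
  have hlog : Real.log ((7 * n ^ 2 : ℕ) : ℝ) + 1 ≤ 3 + 2 * Real.log n := by
    push_cast
    rw [Real.log_mul (by norm_num) (by positivity), Real.log_pow]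
    push_cast
    linarith
  have h : Real.sqrt (n * (Real.log ((7 * n ^ 2 : ℕ) : ℝ) + 1)) ≤
      3 * Real.sqrt (n * Real.log n) + 2 := by
    rcases hn.lt_or_eq with h | rfl
    · have hl : Real.log 2 ≤ Real.log n := Real.log_le_log (by norm_num) (by exact_mod_cast h)
      have h2 := Real.log_two_gt_d9
      have : Real.sqrt (n * (Real.log ((7 * n ^ 2 : ℕ) : ℝ) + 1)) ≤
          3 * Real.sqrt (n * Real.log n) := by
        rw [show (3 : ℝ) = Real.sqrt (3 ^ 2) by rw [Real.sqrt_sq]; norm_num,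
          ← Real.sqrt_mul (by norm_num)]
        refine Real.sqrt_le_sqrt ?_
        nlinarith
      linarith
    · rw [Real.sqrt_le_left (by positivity)]
      simp only [Nat.cast_one, Real.log_one, mul_zero, Real.sqrt_zero] at hlog ⊢
      linarith
  calc facetBound n (7 * n ^ 2) ≤ 3 * Real.exp 6 * ((7 * n ^ 2 : ℕ) : ℝ) ^ 7 *
        Real.exp (10 + 15 * Real.sqrt (n * Real.log n)) := by
        rw [facetBound]
        gcongr
        linarith
    _ = _ := by
        rw [Real.exp_add, show (16 : ℝ) = 6 + 10 by norm_num, Real.exp_add]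
        push_cast
        ring

/-- All constants are absorbed in one. -/
theorem const_mul_pow_mul_exp_le {D Y b t : ℝ} {a C : ℕ} (hD : D ≤ C) (ha : a ≤ C)
    (hb : b ≤ C) (hY : 1 ≤ Y) (ht : 0 ≤ t) :
    D * Y ^ a * Real.exp (b * t) ≤ C * Y ^ C * Real.exp (C * t) := by
  gcongr

/-! ### The subexponential bounds -/

namespace MDP

variable {S : Type u} {A : Type v} [Fintype S] [DecidableEq S] [DecidableEq A] [Fintype A]

theorem cost_randomFacet_le_facetBound [Nonempty S] {M : MDP S A} {Val : Policy S A → ℝ}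
    (hV : M.IsObjective Val) (f : ℕ) {G : Finset (S × A)} {π : Policy S A} (hπ : pairs π ⊆ G)
    {N : ℕ} (hN : G.card ≤ N) :
    (M.randomFacet f G π).cost ≤ ENNReal.ofReal (facetBound (Fintype.card S) N) := by
  obtain ⟨m, hm⟩ : ∃ m, G.card = Fintype.card S + m :=
    Nat.exists_eq_add_of_le (by rw [← card_pairs π]; exact Finset.card_le_card hπ)
  obtain ⟨r, hr, hle⟩ := exists_facetFactor_le (n := Fintype.card S) (N := N) (m := m)
    Fintype.card_pos (by omega) (by omega)
  refine (cost_randomFacet_le hV hr f G π (Fintype.card S) m hπ hm (Nat.le_add_left _ _)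
    (c := N + 2) ?_).trans (ENNReal.ofReal_le_ofReal hle)
  have : (G.card : ℝ) ≤ N := by exact_mod_cast hN
  linarith

theorem weightsAfter_zero (πs : Policy S A) : WeightsAfter πs 0 fun _ => 0 := by
  constructor
  · exact Nat.zero_le _
  · simp

theorem cost_clarksonLoop_le_exp [Nonempty S] [Nonempty A] {M : MDP S A} {Val : Policy S A → ℝ}
    (hV : M.IsObjective Val)
    (hnk : 6 * Fintype.card S ^ 2 ≤ Fintype.card S * Fintype.card A) (π₀ : Policy S A) (f j : ℕ) :
    (M.clarksonLoop π₀ f j fun _ => 0).cost ≤ ENNReal.ofReal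
      (8 * (8 + 3 * Real.exp 16 * 7 ^ 7) * ((Fintype.card S : ℝ) * Fintype.card A) ^ 16 *
        Real.exp (15 * Real.sqrt (Fintype.card S * Real.log (Fintype.card S)))) := by
  obtain ⟨πs, -, hs⟩ := hV.exists_not_improving (Finset.subset_univ (pairs π₀))
  set n := Fintype.card S with hn
  set k := Fintype.card A with hk
  have hn1 : 1 ≤ n := Fintype.card_pos
  have hk1 : 1 ≤ k := Fintype.card_pos
  have hb : ∀ G : Finset (S × A), pairs π₀ ⊆ G → G.card ≤ 6 * n ^ 2 + n →
      (M.randomFacet f G π₀).cost ≤ ENNReal.ofReal (facetBound n (7 * n ^ 2)) := by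
    intro G hG hcard
    refine cost_randomFacet_le_facetBound hV f hG (hcard.trans ?_)
    nlinarith
  refine (cost_clarksonLoop_le hV hnk π₀ f (fun p => hs p (Finset.mem_univ p)) hb j 0 _
    (weightsAfter_zero πs)).trans ?_
  have hfb0 : 0 ≤ facetBound n (7 * n ^ 2) := by
    rw [facetBound]
    positivity
  have hn1' : (1 : ℝ) ≤ n := by exact_mod_cast hn1
  have hk1' : (1 : ℝ) ≤ k := by exact_mod_cast hk1
  set Y : ℝ := (n : ℝ) * k with hY
  have hnY : (n : ℝ) ≤ Y := le_mul_of_one_le_right (by positivity) hk1'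
  have hY1 : 1 ≤ Y := hn1'.trans hnY
  set D : ℝ := 3 * Real.exp 16 * 7 ^ 7 with hD
  set E : ℝ := Real.exp (15 * Real.sqrt (n * Real.log n)) with hE
  have hE1 : 1 ≤ E := Real.one_le_exp (by positivity)
  have hconv : (2 * ((1 + 6 * n ^ 2 + n * k : ℕ) + ENNReal.ofReal (facetBound n (7 * n ^ 2))) *
      (3 * (n * k * n) + 1 - 0 : ℕ) : ℝ≥0∞) =
      ENNReal.ofReal (2 * ((1 + 6 * n ^ 2 + n * k) + facetBound n (7 * n ^ 2)) *
        (3 * (n * k * n) + 1)) := by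
    rw [ENNReal.ofReal_mul (by positivity), ENNReal.ofReal_mul (by positivity),
      ENNReal.ofReal_add (by positivity) hfb0, Nat.sub_zero, ← ENNReal.ofReal_natCast,
      ← ENNReal.ofReal_natCast]
    push_cast
    simp
  rw [hconv]
  refine ENNReal.ofReal_le_ofReal ?_
  have hfb : facetBound n (7 * n ^ 2) ≤ D * Y ^ 14 * E := by
    refine (facetBound_seven_sq_le hn1).trans ?_
    gcongr
  have hY2 : Y ≤ Y ^ 2 := le_self_pow₀ hY1 (by norm_num)
  have hYE : Y ^ 2 ≤ Y ^ 14 * E := by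
    calc Y ^ 2 ≤ Y ^ 14 := pow_le_pow_right₀ hY1 (by norm_num)
      _ ≤ Y ^ 14 * E := le_mul_of_one_le_right (by positivity) hE1
  have hn2 : (n : ℝ) ^ 2 ≤ Y ^ 2 := by gcongr
  have h1 : (1 + 6 * (n : ℝ) ^ 2 + Y) + facetBound n (7 * n ^ 2) ≤ (8 + D) * (Y ^ 14 * E) := by
    nlinarith
  have h2 : 3 * (Y * n) + 1 ≤ 4 * Y ^ 2 := by nlinarith
  calc 2 * ((1 + 6 * (n : ℝ) ^ 2 + Y) + facetBound n (7 * n ^ 2)) * (3 * (Y * n) + 1)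
      ≤ 2 * ((8 + D) * (Y ^ 14 * E)) * (4 * Y ^ 2) := by gcongr
    _ = _ := by ring

end MDP

/-! ### Termination, optimality and expected number of steps -/

theorem RandM.expectedSteps_le {α : Type u} {run : ℕ → RandM α} {b : ℝ≥0∞}
    (h : ∀ f, (run f).cost ≤ b) : expectedSteps run ≤ b := iSup_le h

theorem mainTheorem1 :
    ∃ C : ℕ, ∀ (S : Type u) (A : Type v) [Fintype S] [DecidableEq S] [Nonempty S]
      [Fintype A] [DecidableEq A] [Nonempty A] (M : MDP S A) (π₀ : Policy S A) (n k : ℕ),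
      n = Fintype.card S → k = Fintype.card A →
      (RandM.TerminatesAlmostSurely (M.randomFacetBlackwell π₀) ∧
        RandM.AlwaysReturns (M.randomFacetBlackwell π₀) M.IsBlackwellOptimal ∧
        RandM.expectedSteps (M.randomFacetBlackwell π₀) ≤
          ENNReal.ofReal (C * ((n : ℝ) * k) ^ C *
            Real.exp (C * Real.sqrt (n * Real.log (n * k))))) ∧
      (RandM.TerminatesAlmostSurely (M.clarksonRandomFacetBlackwell π₀) ∧
        RandM.AlwaysReturns (M.clarksonRandomFacetBlackwell π₀) M.IsBlackwellOptimal ∧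
        RandM.expectedSteps (M.clarksonRandomFacetBlackwell π₀) ≤
          ENNReal.ofReal (C * ((n : ℝ) * k) ^ C *
            Real.exp (C * Real.sqrt (n * Real.log n)))) := by
  -- The coefficients of the bounds of both parts; the exponents are at most `16`.
  obtain ⟨C, hC⟩ := exists_nat_ge
    (8 * (8 + 3 * Real.exp 16 * 7 ^ 7) + 3 * Real.exp 11 + 16)
  have he16 := Real.exp_pos 16
  have he11 := Real.exp_pos 11
  have hC16 : 16 ≤ C := by
    have : (16 : ℝ) ≤ C := by linarith
    exact_mod_cast this
  have hC16' : (16 : ℝ) ≤ C := by exact_mod_cast hC16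
  refine ⟨C, fun S A _ _ _ _ _ _ M π₀ n k hn hk => ?_⟩
  obtain ⟨γ', h0, h1, himp⟩ := M.exists_discount_improving_iff
  have hV := M.isObjective_sum_value h0 h1 (himp γ' le_rfl h1)
  have hBO : ∀ {π : Policy S A}, (∀ p, ¬ M.Improving π p) → M.IsBlackwellOptimal π :=
    fun hπ => M.isBlackwellOptimal_of_not_improving h0 h1 himp hπ
  have hn1 : 1 ≤ n := hn ▸ Fintype.card_pos
  have hk1 : 1 ≤ k := hk ▸ Fintype.card_pos
  have hnk1 : (1 : ℝ) ≤ (n : ℝ) * k := by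
    exact_mod_cast Nat.mul_pos hn1 hk1
  have hcard : (Finset.univ : Finset (S × A)).card = n * k := by
    rw [Finset.card_univ, Fintype.card_prod, hn, hk]
  have hRF := fun f => MDP.ensures_randomFacet hV f Finset.univ π₀ (Finset.subset_univ _)
  have hRFcost : RandM.expectedSteps (M.randomFacetBlackwell π₀) ≤
      ENNReal.ofReal (C * ((n : ℝ) * k) ^ C *
        Real.exp (C * Real.sqrt (n * Real.log (n * k)))) := by
    refine RandM.expectedSteps_le fun f => ?_
    refine (MDP.cost_randomFacet_le_facetBound hV f (Finset.subset_univ (MDP.pairs π₀))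
      hcard.le).trans (ENNReal.ofReal_le_ofReal ?_)
    rw [← hn]
    refine (facetBound_le_of_le hn1 (Nat.le_mul_of_pos_right n hk1)).trans ?_
    push_cast
    exact const_mul_pow_mul_exp_le (by linarith) (by omega) (by linarith) hnk1
      (Real.sqrt_nonneg _)
  have hRFresult : RandM.AlwaysReturns (M.randomFacetBlackwell π₀) M.IsBlackwellOptimal :=
    fun f π c hc => hBO fun p => ((hRF f _ _ hc).2 π rfl).2 p (Finset.mem_univ p)
  have hRFcut : ∀ f, RandM.Ensures (M.randomFacetBlackwell π₀ f) fun x c => x = none → f ≤ c :=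
    fun f x c hx => (hRF f x c hx).1
  have hRFterm := RandM.terminatesAlmostSurely_of_expectedSteps_lt_top hRFcut
    (hRFcost.trans_lt ENNReal.ofReal_lt_top)
  refine ⟨⟨hRFterm, hRFresult, hRFcost⟩, ?_⟩
  by_cases hsmall : Fintype.card S * Fintype.card A ≤ 6 * Fintype.card S ^ 2
  · have heq : M.clarksonRandomFacetBlackwell π₀ = M.randomFacetBlackwell π₀ :=
      funext fun f => if_pos hsmall
    rw [heq]
    refine ⟨hRFterm, hRFresult, RandM.expectedSteps_le fun f => ?_⟩
    refine (MDP.cost_randomFacet_le_facetBound hV f (Finset.subset_univ (MDP.pairs π₀))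
      (N := 7 * n ^ 2) ?_).trans (ENNReal.ofReal_le_ofReal ?_)
    · rw [← hn, ← hk] at hsmall
      rw [hcard]
      nlinarith
    · rw [← hn]
      refine (facetBound_seven_sq_le hn1).trans ?_
      have hle : (n : ℝ) ≤ n * k :=
        le_mul_of_one_le_right (Nat.cast_nonneg n) (by exact_mod_cast hk1)
      calc _ ≤ 3 * Real.exp 16 * 7 ^ 7 * ((n : ℝ) * k) ^ 14 *
            Real.exp (15 * Real.sqrt (n * Real.log n)) := by gcongr
        _ ≤ _ := const_mul_pow_mul_exp_le (by linarith) (by omega) (by linarith) hnk1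
            (Real.sqrt_nonneg _)
  · have heq : M.clarksonRandomFacetBlackwell π₀ = fun f => M.clarksonLoop π₀ f f fun _ => 0 :=
      funext fun f => if_neg hsmall
    rw [heq]
    have hlarge := (not_le.1 hsmall).le
    have hloop := fun f => MDP.ensures_clarksonLoop hV hlarge π₀ f f le_rfl fun _ => 0
    have hcost : RandM.expectedSteps (fun f => M.clarksonLoop π₀ f f fun _ => 0) ≤
        ENNReal.ofReal (C * ((n : ℝ) * k) ^ C *
          Real.exp (C * Real.sqrt (n * Real.log n))) := by
      refine RandM.expectedSteps_le fun f => ?_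
      refine (MDP.cost_clarksonLoop_le_exp hV hlarge π₀ f f).trans (ENNReal.ofReal_le_ofReal ?_)
      rw [← hn, ← hk]
      exact const_mul_pow_mul_exp_le (by linarith) hC16 (by linarith) hnk1 (Real.sqrt_nonneg _)
    exact ⟨RandM.terminatesAlmostSurely_of_expectedSteps_lt_top
        (fun f x c hx => (hloop f x c hx).1) (hcost.trans_lt ENNReal.ofReal_lt_top),
      fun f π c hc => hBO ((hloop f _ _ hc).2 π rfl), hcost⟩
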